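/- Let $d\ge 1$ and let $X=(X_t)_{t\ge 0}$ be an isotropic unimodal Lévy process in $\mathbb R^d$: a Lévy process such that, for every $t>0$, the distribution of $X_t$ is, on $\mathbb R^d\setminus\{0\}$, absolutely continuous with a finite radial nonincreasing density $p_t(x)$ (an atom at the origin is allowed). Let $\psi$ be its Lévy–Khintchine exponent and $\nu$ its Lévy measure, i.e. $\mathbb E e^{i\langle \xi,X_t\rangle}=e^{-t\psi(\xi)}$ for $t\ge 0$, $\xi\in\mathbb R^d$, with $$\psi(\xi)=\sigma|\xi|^2+\int_{\mathbb R^d}(1-\cos\langle\xi,x\rangle)\,\nu(dx),\qquad \sigma\ge 0,\quad \nu(\{0\})=0,\quad \int_{\mathbb R^d}(|x|^2\wedge 1)\,\nu(dx)<\infty ,$$ where $\nu(dx)=\nu(x)\,dx$ with a finite radial nonincreasing density $\nu(x)$ on $\mathbb R^d\setminus\{0\}$. The function $\psi$ is radial; write $\psi(u)=\psi(\xi)$ if $|\xi|=u$, and let $\psi^*(u)=\sup_{0\le s\le u}\psi(s)$, $u\ge 0$. Say that $\psi$ satisfies WLSC if there are $\underline\alpha\in(0,2)$, $\underline\theta\ge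 0$ and $\underline c\in(0,1]$ such that $\psi(\lambda\theta)\ge \underline c\,\lambda^{\underline\alpha}\psi(\theta)$ for all $\lambda\ge 1$, $\theta>\underline\theta$, and that it satisfies WUSC if there are $\overline\alpha\in(0,2)$, $\overline\theta\ge 0$ and $\overline C\in[1,\infty)$ such that $\psi(\lambda\theta)\le \overline C\,\lambda^{\overline\alpha}\psi(\theta)$ for all $\lambda\ge 1$, $\theta>\overline\theta$. These conditions are called global if one can take $\underline\theta=0$, resp. $\overline\theta=0$. The following are equivalent: (i) WLSC and WUSC hold for $\psi$; (ii) there are $r,c>0$ such that $p_t(x)\ge c\,\dfrac{t\psi^*(|x|^{-1})}{|x|^d}$ whenever $0<|x|<r$ and $0<t\psi^*(|x|^{-1})<1$; (iii) there are $r,c>0$ such that $\nu(x)\ge c\,\dfrac{\psi^*(|x|^{-1})}{|x|^d}$ whenever $0<|x|<r$. If instead one assumes global WLSC and global WUSC in (i), and lets $r=\infty$ in (ii) and (iii), then the three conditions are equivalent, too. -/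

import Mathlib

open MeasureTheory ProbabilityTheory Filter Topology
open scoped NNReal ENNReal

noncomputable section

/-- A Lévy process with values in `ℝ^d` on `(Ω, P)`: a stochastic process starting at `0` almost
surely, with independent and stationary increments and almost surely càdlàg paths. -/
structure IsLevyProcess {d : ℕ} {Ω : Type*} [MeasurableSpace Ω] (P : Measure Ω)
    (X : ℝ≥0 → Ω → EuclideanSpace ℝ (Fin d)) : Prop where
  measurable : ∀ t, Measurable (X t)
  zero : ∀ᵐ ω ∂P, X 0 ω = 0
  indep : HasIndepIncrements X P
  stationary : ∀ s t, P.map (fun ω => X (s + t) ω - X s ω) = P.map (X t)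
  cadlag : ∀ᵐ ω ∂P, ∀ t : ℝ≥0,
    ContinuousWithinAt (fun s => X s ω) (Set.Ici t) t ∧
      ∃ l, Tendsto (fun s => X s ω) (𝓝[<] t) (𝓝 l)

/-- On `ℝ^d \ {0}` the measure `m` is absolutely continuous, and `f` is a finite, radial,
nonincreasing version of its density there. (An atom of `m` at the origin is allowed, and the
value `f 0` is irrelevant.) A measure is isotropic unimodal iff it has such a density. -/
structure HasUnimodalDensity {d : ℕ} (m : Measure (EuclideanSpace ℝ (Fin d)))
    (f : EuclideanSpace ℝ (Fin d) → ℝ) : Prop where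
  nonneg : ∀ x, x ≠ 0 → 0 ≤ f x
  radial_nonincreasing : ∀ x y, x ≠ 0 → ‖x‖ ≤ ‖y‖ → f y ≤ f x
  restrict_eq : m.restrict {0}ᶜ = volume.withDensity (fun x => ENNReal.ofReal (f x))

/-- `N` is a Lévy measure on `ℝ^d`: it is concentrated on `ℝ^d \ {0}` and
`∫ (|x|² ∧ 1) N(dx) < ∞`. -/
structure IsLevyMeasure {d : ℕ} (N : Measure (EuclideanSpace ℝ (Fin d))) : Prop where
  zero : N {0} = 0
  lintegral_lt_top : ∫⁻ x, ENNReal.ofReal (min (‖x‖ ^ 2) 1) ∂N < ∞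

/-- `ψ` is the Lévy-Khintchine (characteristic) exponent of the isotropic process `X`, and `N` is
its Lévy measure: `E exp(i⟨ξ, X_t⟩) = exp(-t ψ(ξ))`, where
`ψ(ξ) = σ |ξ|² + ∫ (1 - cos⟨ξ, x⟩) N(dx)` for some `σ ≥ 0`. -/
structure HasLevyKhintchine {d : ℕ} {Ω : Type*} [MeasurableSpace Ω] (P : Measure Ω)
    (X : ℝ≥0 → Ω → EuclideanSpace ℝ (Fin d)) (ψ : EuclideanSpace ℝ (Fin d) → ℝ)
    (N : Measure (EuclideanSpace ℝ (Fin d))) : Prop where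
  charFun_eq : ∀ (t : ℝ≥0) (ξ : EuclideanSpace ℝ (Fin d)),
    charFun (P.map (X t)) ξ = Complex.exp (-((t : ℝ) * ψ ξ : ℝ))
  isLevyMeasure : IsLevyMeasure N
  formula : ∃ σ : ℝ, 0 ≤ σ ∧ ∀ ξ,
    ψ ξ = σ * ‖ξ‖ ^ 2 + ∫ x, (1 - Real.cos (inner ℝ ξ x)) ∂N

/-- The profile `u ↦ ψ(u e)` of a radial function `ψ` on `ℝ^d`, `d ≥ 1`; here `e` is the first
vector of the standard basis, so that `ψ(ξ) = ψ(u)` if `|ξ| = u`. -/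
def radialProfile {d : ℕ} [NeZero d] (ψ : EuclideanSpace ℝ (Fin d) → ℝ) (u : ℝ) : ℝ :=
  ψ (EuclideanSpace.single (0 : Fin d) u)

/-- The maximal function `φ^*(u) = sup_{0 ≤ s ≤ u} φ(s)`, `u ≥ 0`. -/
def maximalFunction (φ : ℝ → ℝ) (u : ℝ) : ℝ :=
  sSup (φ '' Set.Icc 0 u)

/-- The weak lower scaling inequality with exponent `α`, threshold `θ₀` and constant `c`. -/
def WLSC (φ : ℝ → ℝ) (α θ₀ c : ℝ) : Prop :=
  ∀ lam θ : ℝ, 1 ≤ lam → θ₀ < θ → c * lam ^ α * φ θ ≤ φ (lam * θ)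

/-- The weak upper scaling inequality with exponent `α`, threshold `θ₀` and constant `C`. -/
def WUSC (φ : ℝ → ℝ) (α θ₀ C : ℝ) : Prop :=
  ∀ lam θ : ℝ, 1 ≤ lam → θ₀ < θ → φ (lam * θ) ≤ C * lam ^ α * φ θ

/-- `φ` satisfies a weak lower scaling condition (at infinity), with exponent in `(0, 2)`. -/
def HasWLSC (φ : ℝ → ℝ) : Prop :=
  ∃ α θ₀ c : ℝ, 0 < α ∧ α < 2 ∧ 0 ≤ θ₀ ∧ 0 < c ∧ c ≤ 1 ∧ WLSC φ α θ₀ c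

/-- `φ` satisfies a weak upper scaling condition (at infinity), with exponent in `(0, 2)`. -/
def HasWUSC (φ : ℝ → ℝ) : Prop :=
  ∃ α θ₀ C : ℝ, 0 < α ∧ α < 2 ∧ 0 ≤ θ₀ ∧ 1 ≤ C ∧ WUSC φ α θ₀ C

/-- `φ` satisfies a global weak lower scaling condition, with exponent in `(0, 2)`. -/
def HasGlobalWLSC (φ : ℝ → ℝ) : Prop :=
  ∃ α c : ℝ, 0 < α ∧ α < 2 ∧ 0 < c ∧ c ≤ 1 ∧ WLSC φ α 0 c

/-- `φ` satisfies a global weak upper scaling condition, with exponent in `(0, 2)`. -/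
def HasGlobalWUSC (φ : ℝ → ℝ) : Prop :=
  ∃ α C : ℝ, 0 < α ∧ α < 2 ∧ 1 ≤ C ∧ WUSC φ α 0 C

end

/-! The exponent is replaced by its Gaussian average `G u = ∫ ψ (√2 u y) γ(dy)`, which equals `b u²
+ ∫ (1 - exp (-u²|x|²)) N(dx)`. Unlike `ψ`, the function `G` is monotone, and `G (l u) ≤ (1 + l²) G
u`. The bound `ψ ≤ C G` is elementary; `G ≤ C ψ` uses unimodality through
`measure_halfspace_le_lintegral_one_sub_cos`. Hence `G`, `ψ` and `ψ^*` are comparable. The same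
transform applied to the law of `X_t` lies between `t G - C (t G)²` and `t G`, so the Lévy measure
and the laws of the process can be treated alike (`exists_gaussTransform_comparison`).

From scaling to densities (`exists_density_lower_bound`): the transform at `u²` is at most the mass
of an annulus plus two errors, `2 k⁻²` times the transform at `(k u)²` and twice the transform at
`(u / l)²`. An upper exponent below 2 makes the first error small for large `k`, and a positive
lower exponent makes the second small for large `l`. The annulus therefore carries mass of order `τ
G u`, with `τ = 1` for the Lévy measure and `τ = t` for the law of `X_t`. Since the density is
radially nonincreasing, its value at the inner radius is large.

From densities to scaling: a lower bound at `|x| = 1/u` gives mass to the annulus `|x|/2 ≤ |y| ≤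
|x|`. This mass is felt in both `G (2u) - G u` and `4 G u - G (2u)`, so `(1 + c) G u ≤ G (2u) ≤ (4 -
c) G u`. Iterating (`scaling_of_doubling`) yields exponents `log₂ (1 + c) > 0` and `log₂ (4 - c) <
2`. For transition densities the inequalities are divided by `t` and `t → 0`, which removes the
quadratic error. -/

/-! ### Unimodal densities and masses of annuli -/

theorem HasUnimodalDensity.measure_eq_setLIntegral {d : ℕ}
    {m : Measure (EuclideanSpace ℝ (Fin d))} {f : EuclideanSpace ℝ (Fin d) → ℝ}
    (h : HasUnimodalDensity m f) {A : Set (EuclideanSpace ℝ (Fin d))} (hA : MeasurableSet A)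
    (hA0 : (0 : EuclideanSpace ℝ (Fin d)) ∉ A) :
    m A = ∫⁻ x in A, ENNReal.ofReal (f x) := by
  rw [← withDensity_apply _ hA, ← h.restrict_eq, Measure.restrict_apply hA]
  congr 1
  symm
  rw [Set.inter_eq_left]
  intro x hx hx0
  exact hA0 (by simpa using hx0 ▸ hx)

theorem HasUnimodalDensity.measureReal_le {d : ℕ} [NeZero d]
    {m : Measure (EuclideanSpace ℝ (Fin d))} {f : EuclideanSpace ℝ (Fin d) → ℝ}
    (h : HasUnimodalDensity m f) {A : Set (EuclideanSpace ℝ (Fin d))} (hA : MeasurableSet A)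
    {x : EuclideanSpace ℝ (Fin d)} (hx : x ≠ 0) {R : ℝ} (hR : 0 ≤ R)
    (hAx : ∀ y ∈ A, ‖x‖ ≤ ‖y‖ ∧ ‖y‖ ≤ R) :
    m.real A ≤ f x * (R ^ d * volume.real (Metric.ball (0 : EuclideanSpace ℝ (Fin d)) 1)) := by
  have hA0 : (0 : EuclideanSpace ℝ (Fin d)) ∉ A := by
    intro h0
    have := (hAx 0 h0).1
    simp at this
    exact hx this
  have h1 : m A ≤ ENNReal.ofReal (f x) * volume (Metric.closedBall
      (0 : EuclideanSpace ℝ (Fin d)) R) := by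
    rw [h.measure_eq_setLIntegral hA hA0]
    calc ∫⁻ y in A, ENNReal.ofReal (f y) ≤ ∫⁻ _ in A, ENNReal.ofReal (f x) :=
          setLIntegral_mono' hA fun y hy =>
            ENNReal.ofReal_le_ofReal (h.radial_nonincreasing x y hx (hAx y hy).1)
      _ = ENNReal.ofReal (f x) * volume A := by simp
      _ ≤ _ := by
          gcongr
          intro y hy
          simpa using (hAx y hy).2
  have h2 : ENNReal.ofReal (f x) * volume (Metric.closedBall
      (0 : EuclideanSpace ℝ (Fin d)) R) ≠ ∞ :=
    ENNReal.mul_ne_top ENNReal.ofReal_ne_top measure_closedBall_lt_top.ne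
  have h3 := ENNReal.toReal_mono h2 h1
  rw [ENNReal.toReal_mul, ENNReal.toReal_ofReal (h.nonneg x hx),
    Measure.addHaar_closedBall _ _ hR, ENNReal.toReal_mul,
    ENNReal.toReal_ofReal (by positivity)] at h3
  simpa [Measure.real] using h3

theorem volume_real_ball_pos (d : ℕ) :
    0 < volume.real (Metric.ball (0 : EuclideanSpace ℝ (Fin d)) 1) :=
  ENNReal.toReal_pos (Metric.measure_ball_pos _ _ one_pos).ne' measure_ball_lt_top.ne

theorem volume_real_annulus_ge {d : ℕ} [NeZero d] {R : ℝ} (hR : 0 < R) :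
    R ^ d * volume.real (Metric.ball (0 : EuclideanSpace ℝ (Fin d)) 1) / 2 ≤
      volume.real {y : EuclideanSpace ℝ (Fin d) | R / 2 ≤ ‖y‖ ∧ ‖y‖ ≤ R} := by
  have h1 : {y : EuclideanSpace ℝ (Fin d) | R / 2 ≤ ‖y‖ ∧ ‖y‖ ≤ R} =
      Metric.closedBall 0 R \ Metric.ball 0 (R / 2) := by
    ext y; simp [and_comm]
  -- This is where `d ≥ 1` enters: the inner ball takes at most half of the volume.
  have h2 : (R / 2) ^ d ≤ R ^ d / 2 := by
    rw [div_pow]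
    have : (2 : ℝ) ^ 1 ≤ 2 ^ d :=
      pow_le_pow_right₀ (by norm_num) (Nat.one_le_iff_ne_zero.2 (NeZero.ne d))
    gcongr
    simpa using this
  have hv := volume_real_ball_pos d
  rw [h1, measureReal_sdiff (by
      intro y hy
      simp only [Metric.mem_ball, dist_zero_right, Metric.mem_closedBall] at *
      linarith) Metric.isOpen_ball.measurableSet measure_closedBall_lt_top.ne]
  have h3 : volume.real (Metric.closedBall (0 : EuclideanSpace ℝ (Fin d)) R) =
      R ^ d * volume.real (Metric.ball (0 : EuclideanSpace ℝ (Fin d)) 1) := by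
    simp only [Measure.real]
    rw [Measure.addHaar_closedBall _ _ hR.le, ENNReal.toReal_mul,
      ENNReal.toReal_ofReal (by positivity)]
    simp
  have h4 : volume.real (Metric.ball (0 : EuclideanSpace ℝ (Fin d)) (R / 2)) =
      (R / 2) ^ d * volume.real (Metric.ball (0 : EuclideanSpace ℝ (Fin d)) 1) := by
    simp only [Measure.real]
    rw [Measure.addHaar_ball _ _ (by positivity), ENNReal.toReal_mul,
      ENNReal.toReal_ofReal (by positivity)]
    simp
  rw [h3, h4]
  nlinarith

theorem HasUnimodalDensity.le_measureReal_annulus {d : ℕ} [NeZero d]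
    {m : Measure (EuclideanSpace ℝ (Fin d))} {f : EuclideanSpace ℝ (Fin d) → ℝ}
    (h : HasUnimodalDensity m f) {x : EuclideanSpace ℝ (Fin d)} (hx : x ≠ 0)
    (hfin : m {y | ‖x‖ / 2 ≤ ‖y‖ ∧ ‖y‖ ≤ ‖x‖} ≠ ∞) :
    f x * (‖x‖ ^ d * volume.real (Metric.ball (0 : EuclideanSpace ℝ (Fin d)) 1) / 2) ≤
      m.real {y | ‖x‖ / 2 ≤ ‖y‖ ∧ ‖y‖ ≤ ‖x‖} := by
  have hx' : 0 < ‖x‖ := norm_pos_iff.2 hx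
  set A := {y : EuclideanSpace ℝ (Fin d) | ‖x‖ / 2 ≤ ‖y‖ ∧ ‖y‖ ≤ ‖x‖} with hAdef
  have hA : MeasurableSet A := by
    have : IsClosed A := (isClosed_le continuous_const continuous_norm).inter
      (isClosed_le continuous_norm continuous_const)
    exact this.measurableSet
  have hA0 : (0 : EuclideanSpace ℝ (Fin d)) ∉ A := by
    intro h0
    have := h0.1
    rw [norm_zero] at this
    linarith
  have h1 : ENNReal.ofReal (f x) * volume A ≤ m A := by
    rw [h.measure_eq_setLIntegral hA hA0]
    calc ENNReal.ofReal (f x) * volume A = ∫⁻ _ in A, ENNReal.ofReal (f x) := by simp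
      _ ≤ _ := setLIntegral_mono' hA fun y hy => ENNReal.ofReal_le_ofReal
          (h.radial_nonincreasing y x (fun h => hA0 (h ▸ hy)) hy.2)
  have h3 := ENNReal.toReal_mono hfin h1
  rw [ENNReal.toReal_mul, ENNReal.toReal_ofReal (h.nonneg x hx)] at h3
  exact (mul_le_mul_of_nonneg_left (volume_real_annulus_ge hx') (h.nonneg x hx)).trans h3

/-- The density of a unimodal measure without atom at the origin is an antitone function of the
norm. -/
theorem HasUnimodalDensity.exists_antitone {d : ℕ} [NeZero d]
    {m : Measure (EuclideanSpace ℝ (Fin d))} {f : EuclideanSpace ℝ (Fin d) → ℝ}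
    (h : HasUnimodalDensity m f) (h0 : m {0} = 0) :
    ∃ φ : ℝ → ℝ≥0∞, Antitone φ ∧
      m = volume.withDensity (fun x : EuclideanSpace ℝ (Fin d) => φ ‖x‖) := by
  -- The value `∞` on `r ≤ 0` makes the profile antitone on all of `ℝ`; only `r = 0` is ever
  -- attained by a norm there, and the origin is a null set.
  refine ⟨fun r => if r ≤ 0 then ∞ else
    ENNReal.ofReal (f (EuclideanSpace.single 0 r)), ?_, ?_⟩
  · intro a b hab
    by_cases ha : a ≤ 0
    · simp [ha]
    · have hb : ¬ b ≤ 0 := by linarith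
      simp only [ha, hb, if_false]
      refine ENNReal.ofReal_le_ofReal (h.radial_nonincreasing _ _ ?_ ?_)
      · simp; intro h; exact ha h.le
      · push Not at ha hb
        simp [abs_of_pos ha, abs_of_pos hb, hab]
  · have h1 : m = m.restrict {0}ᶜ := by
      rw [Measure.restrict_eq_self_of_ae_mem]
      exact (measure_eq_zero_iff_ae_notMem.1 h0)
    rw [h1, h.restrict_eq]
    refine withDensity_congr_ae ?_
    have : ∀ᵐ x : EuclideanSpace ℝ (Fin d), x ≠ 0 := by
      have : Nontrivial (EuclideanSpace ℝ (Fin d)) := by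
        refine ⟨EuclideanSpace.single 0 1, 0, ?_⟩
        simp
      exact measure_eq_zero_iff_ae_notMem.1 (measure_singleton (0 : EuclideanSpace ℝ (Fin d)))
    filter_upwards [this] with x hx
    have hx' : 0 < ‖x‖ := norm_pos_iff.2 hx
    have hs : ‖(EuclideanSpace.single 0 ‖x‖ : EuclideanSpace ℝ (Fin d))‖ = ‖x‖ := by simp
    have hs0 : (EuclideanSpace.single 0 ‖x‖ : EuclideanSpace ℝ (Fin d)) ≠ 0 := by
      rw [← norm_pos_iff, hs]; exact hx'
    rw [if_neg (by simpa using hx)]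
    congr 1
    exact le_antisymm (h.radial_nonincreasing _ _ hs0 hs.le)
      (h.radial_nonincreasing _ _ hx hs.ge)

/-! ### Lower bounds for `∫ (1 - cos)` under unimodality -/

/-- Translating a half-space away from the origin decreases a unimodal measure; averaging
`1 - cos` over a half-period then leaves at least the mass of the translated half-space. -/
theorem measure_halfspace_le_lintegral_one_sub_cos {d : ℕ} {φ : ℝ → ℝ≥0∞} (hφ : Antitone φ)
    {ξ : EuclideanSpace ℝ (Fin d)} (hξ : ξ ≠ 0) :
    volume.withDensity (fun x : EuclideanSpace ℝ (Fin d) => φ ‖x‖)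
        {x | Real.pi ≤ inner ℝ ξ x} ≤
      ∫⁻ x, ENNReal.ofReal (1 - Real.cos (inner ℝ ξ x))
        ∂(volume.withDensity (fun x : EuclideanSpace ℝ (Fin d) => φ ‖x‖)) := by
  have hφm : Measurable (fun x : EuclideanSpace ℝ (Fin d) => φ ‖x‖) :=
    hφ.measurable.comp measurable_norm
  have hcos : Measurable (fun x : EuclideanSpace ℝ (Fin d) =>
      ENNReal.ofReal (1 - Real.cos (inner ℝ ξ x))) := by fun_prop
  have hcos' : Measurable (fun x : EuclideanSpace ℝ (Fin d) =>
      ENNReal.ofReal (1 + Real.cos (inner ℝ ξ x))) := by fun_prop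
  set v : EuclideanSpace ℝ (Fin d) := (Real.pi / ‖ξ‖ ^ 2) • ξ with hv
  have hξ' : 0 < ‖ξ‖ := norm_pos_iff.2 hξ
  have hiv : inner ℝ ξ v = Real.pi := by
    rw [hv, inner_smul_right, real_inner_self_eq_norm_sq]
    field_simp
  have hS : MeasurableSet {x : EuclideanSpace ℝ (Fin d) | Real.pi ≤ inner ℝ ξ x} :=
    measurableSet_le measurable_const (by fun_prop)
  have hT : MeasurableSet {x : EuclideanSpace ℝ (Fin d) | 0 ≤ inner ℝ ξ x} :=
    measurableSet_le measurable_const (by fun_prop)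
  set S := {x : EuclideanSpace ℝ (Fin d) | Real.pi ≤ inner ℝ ξ x} with hSdef
  set T := {x : EuclideanSpace ℝ (Fin d) | 0 ≤ inner ℝ ξ x} with hTdef
  set I := ∫⁻ x in T, φ ‖x‖ * ENNReal.ofReal (1 - Real.cos (inner ℝ ξ x)) with hI
  have h1 : ∫⁻ x in S, φ ‖x‖ * ENNReal.ofReal (1 - Real.cos (inner ℝ ξ x)) ≤ I := by
    refine lintegral_mono_set fun x hx => ?_
    exact Real.pi_pos.le.trans hx
  have h2 : ∫⁻ x in S, φ ‖x‖ * ENNReal.ofReal (1 + Real.cos (inner ℝ ξ x)) ≤ I := by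
    rw [hI, ← lintegral_indicator hS, ← lintegral_indicator hT,
      ← lintegral_add_right_eq_self _ v]
    refine lintegral_mono fun x => ?_
    by_cases hx : x ∈ T
    · have hxS : x + v ∈ S := by
        simp only [hSdef, Set.mem_ofPred_eq, inner_add_right, hiv]
        have : 0 ≤ inner ℝ ξ x := hx
        linarith
      rw [Set.indicator_of_mem hxS, Set.indicator_of_mem hx]
      refine mul_le_mul' (hφ ?_) ?_
      · have hxv : 0 ≤ inner ℝ x v := by
          rw [hv, inner_smul_right, real_inner_comm]
          exact mul_nonneg (div_nonneg Real.pi_pos.le (sq_nonneg _)) hx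
        refine (sq_le_sq₀ (norm_nonneg _) (norm_nonneg _)).1 ?_
        rw [norm_add_sq_real]
        nlinarith [sq_nonneg ‖v‖]
      · rw [inner_add_right, hiv, Real.cos_add_pi, sub_eq_add_neg]
    · have hxS : x + v ∉ S := by
        simp only [hSdef, Set.mem_ofPred_eq, inner_add_right, hiv]
        intro h
        apply hx
        simp only [hTdef, Set.mem_ofPred_eq]
        linarith
      rw [Set.indicator_of_notMem hxS]
      exact zero_le
  -- The weights `1 - cos` and `1 + cos` add up to 2, and each contributes at most `I`.
  have h3 : 2 * ∫⁻ x in S, φ ‖x‖ ≤ 2 * I := by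
    calc 2 * ∫⁻ x in S, φ ‖x‖ = ∫⁻ x in S, φ ‖x‖ * 2 := by
          rw [lintegral_mul_const _ hφm, mul_comm]
      _ = ∫⁻ x in S, (φ ‖x‖ * ENNReal.ofReal (1 - Real.cos (inner ℝ ξ x)) +
            φ ‖x‖ * ENNReal.ofReal (1 + Real.cos (inner ℝ ξ x))) := by
          refine lintegral_congr fun x => ?_
          rw [← mul_add, ← ENNReal.ofReal_add (by linarith [Real.cos_le_one (inner ℝ ξ x)])
            (by linarith [Real.neg_one_le_cos (inner ℝ ξ x)])]
          congr 1
          ring_nf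
          simp
      _ = _ := lintegral_add_left (hφm.mul hcos) _
      _ ≤ I + I := add_le_add h1 h2
      _ = 2 * I := (two_mul I).symm
  rw [withDensity_apply _ hS, lintegral_withDensity_eq_lintegral_mul _ hφm hcos]
  refine ((ENNReal.mul_le_mul_iff_right (by simp) (by simp)).1 h3).trans ?_
  exact setLIntegral_le_lintegral _ _

/-- Swapping two coordinates is a linear isometry, so it preserves both the volume and the norm. -/
theorem lintegral_coord_withDensity_norm {d : ℕ} {φ : ℝ → ℝ≥0∞} (hφ : Measurable φ)
    {w : ℝ → ℝ≥0∞} (hw : Measurable w) (i j : Fin d) :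
    ∫⁻ x, w (x i) ∂(volume.withDensity (fun x : EuclideanSpace ℝ (Fin d) => φ ‖x‖)) =
      ∫⁻ x, w (x j) ∂(volume.withDensity (fun x : EuclideanSpace ℝ (Fin d) => φ ‖x‖)) := by
  have hφm : Measurable (fun x : EuclideanSpace ℝ (Fin d) => φ ‖x‖) := hφ.comp measurable_norm
  have hm : ∀ k : Fin d, Measurable (fun x : EuclideanSpace ℝ (Fin d) => w (x k)) := fun k =>
    hw.comp (by fun_prop)
  let e := LinearIsometryEquiv.piLpCongrLeft 2 ℝ ℝ (Equiv.swap i j)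
  rw [lintegral_withDensity_eq_lintegral_mul _ hφm (hm i),
    lintegral_withDensity_eq_lintegral_mul _ hφm (hm j),
    ← e.measurePreserving.lintegral_comp (hφm.mul (hm i))]
  refine lintegral_congr fun x => ?_
  simp only [Pi.mul_apply]
  rw [e.norm_map]
  congr 2
  simp [e, LinearIsometryEquiv.piLpCongrLeft_apply, Equiv.piCongrLeft']

/-- For `|a| ≤ π` one has `1 - cos a ≥ (2/π²) a² ≥ a²/5`. Where `|u x_i| ≥ π` the cosine may be
close to 1, and the two half-spaces are handled by the translation argument. Hence 7 = 5 + 1 + 1. -/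
theorem lintegral_min_coord_sq_le {d : ℕ} {φ : ℝ → ℝ≥0∞} (hφ : Antitone φ)
    (i : Fin d) {u : ℝ} (hu : 0 < u) :
    ∫⁻ x, ENNReal.ofReal (min 1 (u ^ 2 * (x i) ^ 2))
        ∂(volume.withDensity (fun x : EuclideanSpace ℝ (Fin d) => φ ‖x‖)) ≤
      7 * ∫⁻ x, ENNReal.ofReal (1 - Real.cos (u * x i))
        ∂(volume.withDensity (fun x : EuclideanSpace ℝ (Fin d) => φ ‖x‖)) := by
  set m := volume.withDensity (fun x : EuclideanSpace ℝ (Fin d) => φ ‖x‖) with hm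
  set J := ∫⁻ x, ENNReal.ofReal (1 - Real.cos (u * x i)) ∂m with hJ
  have hsing : ∀ (c : ℝ) (x : EuclideanSpace ℝ (Fin d)),
      inner ℝ (EuclideanSpace.single i c) x = c * x i := by
    intro c x
    simp [EuclideanSpace.inner_single_left]
  have hp : m {x | Real.pi ≤ u * x i} ≤ J := by
    have := measure_halfspace_le_lintegral_one_sub_cos hφ
      (ξ := EuclideanSpace.single i u) (by simpa using hu.ne')
    simpa only [hsing] using this
  have hn : m {x | Real.pi ≤ -u * x i} ≤ J := by
    have := measure_halfspace_le_lintegral_one_sub_cos hφ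
      (ξ := EuclideanSpace.single i (-u)) (by simpa using hu.ne')
    simpa only [hsing, neg_mul, Real.cos_neg] using this
  have hSp : MeasurableSet {x : EuclideanSpace ℝ (Fin d) | Real.pi ≤ u * x i} :=
    measurableSet_le measurable_const (by fun_prop)
  have hSn : MeasurableSet {x : EuclideanSpace ℝ (Fin d) | Real.pi ≤ -u * x i} :=
    measurableSet_le measurable_const (by fun_prop)
  have hcm : Measurable (fun x : EuclideanSpace ℝ (Fin d) =>
      ENNReal.ofReal (1 - Real.cos (u * x i))) := by fun_prop
  have key : ∀ x : EuclideanSpace ℝ (Fin d), ENNReal.ofReal (min 1 (u ^ 2 * (x i) ^ 2)) ≤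
      5 * ENNReal.ofReal (1 - Real.cos (u * x i)) +
        ({x | Real.pi ≤ u * x i}.indicator 1 x +
          {x | Real.pi ≤ -u * x i}.indicator 1 x) := by
    intro x
    by_cases h1 : Real.pi ≤ u * x i
    · rw [Set.indicator_of_mem (show x ∈ {x : EuclideanSpace ℝ (Fin d) | Real.pi ≤ u * x i}
        from h1)]
      calc _ ≤ ENNReal.ofReal 1 := ENNReal.ofReal_le_ofReal (min_le_left _ _)
        _ = 1 := by simp
        _ ≤ _ := by
          rw [← add_assoc, add_right_comm]; exact le_add_self
    by_cases h2 : Real.pi ≤ -u * x i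
    · rw [Set.indicator_of_mem (show x ∈ {x : EuclideanSpace ℝ (Fin d) | Real.pi ≤ -u * x i}
        from h2)]
      calc _ ≤ ENNReal.ofReal 1 := ENNReal.ofReal_le_ofReal (min_le_left _ _)
        _ = 1 := by simp
        _ ≤ _ := by
          rw [← add_assoc]; exact le_add_self
    · refine le_trans ?_ le_self_add
      rw [show (5 : ℝ≥0∞) = ENNReal.ofReal 5 by norm_num, ← ENNReal.ofReal_mul (by norm_num)]
      refine ENNReal.ofReal_le_ofReal ((min_le_right _ _).trans ?_)
      have habs : |u * x i| ≤ Real.pi := by rw [abs_le]; constructor <;> nlinarith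
      have := Real.cos_le_one_sub_mul_cos_sq habs
      have hpi : Real.pi ^ 2 ≤ 10 := by nlinarith [Real.pi_lt_d2, Real.pi_pos]
      have hpi0 : 0 < Real.pi ^ 2 := by positivity
      have h3 : 1 / 5 ≤ 2 / Real.pi ^ 2 := by
        rw [div_le_div_iff₀ (by norm_num) hpi0]; linarith
      have h4 : 1 / 5 * (u * x i) ^ 2 ≤ 2 / Real.pi ^ 2 * (u * x i) ^ 2 := by gcongr
      nlinarith
  calc _ ≤ ∫⁻ x, (5 * ENNReal.ofReal (1 - Real.cos (u * x i)) +
        ({x | Real.pi ≤ u * x i}.indicator 1 x + {x | Real.pi ≤ -u * x i}.indicator 1 x)) ∂m :=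
        lintegral_mono key
    _ = 5 * J + (m {x | Real.pi ≤ u * x i} + m {x | Real.pi ≤ -u * x i}) := by
        rw [lintegral_add_left (by fun_prop), lintegral_const_mul _ hcm,
          lintegral_add_left (measurable_one.indicator hSp), lintegral_indicator_one hSp,
          lintegral_indicator_one hSn]
    _ ≤ 5 * J + (J + J) := by gcongr
    _ = 7 * J := by ring

theorem lintegral_min_norm_sq_le {d : ℕ} [NeZero d] {φ : ℝ → ℝ≥0∞} (hφ : Antitone φ)
    {u : ℝ} (hu : 0 < u) :
    ∫⁻ x, ENNReal.ofReal (min 1 (u ^ 2 * ‖x‖ ^ 2))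
        ∂(volume.withDensity (fun x : EuclideanSpace ℝ (Fin d) => φ ‖x‖)) ≤
      (7 * d) * ∫⁻ x, ENNReal.ofReal (1 - Real.cos (u * x 0))
        ∂(volume.withDensity (fun x : EuclideanSpace ℝ (Fin d) => φ ‖x‖)) := by
  set m := volume.withDensity (fun x : EuclideanSpace ℝ (Fin d) => φ ‖x‖) with hm
  have key : ∀ x : EuclideanSpace ℝ (Fin d), ENNReal.ofReal (min 1 (u ^ 2 * ‖x‖ ^ 2)) ≤
      ∑ i, ENNReal.ofReal (min 1 (u ^ 2 * (x i) ^ 2)) := by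
    intro x
    rw [← ENNReal.ofReal_sum_of_nonneg (fun i _ => by positivity)]
    refine ENNReal.ofReal_le_ofReal ?_
    by_cases h : ∃ i, 1 ≤ u ^ 2 * (x i) ^ 2
    · obtain ⟨i, hi⟩ := h
      refine ((min_le_left _ _).trans (min_eq_left hi).ge).trans ?_
      exact Finset.single_le_sum (f := fun i => min 1 (u ^ 2 * (x i) ^ 2))
        (fun i _ => by positivity) (Finset.mem_univ i)
    · push Not at h
      refine (min_le_right _ _).trans ?_
      rw [EuclideanSpace.real_norm_sq_eq, Finset.mul_sum]
      exact Finset.sum_le_sum fun i _ => by rw [min_eq_right (h i).le]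
  calc _ ≤ ∫⁻ x, ∑ i, ENNReal.ofReal (min 1 (u ^ 2 * (x i) ^ 2)) ∂m := lintegral_mono key
    _ = ∑ i, ∫⁻ x, ENNReal.ofReal (min 1 (u ^ 2 * (x i) ^ 2)) ∂m :=
        lintegral_finsetSum _ fun i _ => by fun_prop
    _ = ∑ i : Fin d, ∫⁻ x, ENNReal.ofReal (min 1 (u ^ 2 * (x 0) ^ 2)) ∂m := by
        refine Finset.sum_congr rfl fun i _ => ?_
        exact lintegral_coord_withDensity_norm hφ.measurable
          (w := fun z => ENNReal.ofReal (min 1 (u ^ 2 * z ^ 2))) (by fun_prop) i 0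
    _ = d * ∫⁻ x, ENNReal.ofReal (min 1 (u ^ 2 * (x 0) ^ 2)) ∂m := by simp
    _ ≤ d * (7 * ∫⁻ x, ENNReal.ofReal (1 - Real.cos (u * x 0)) ∂m) := by
        gcongr
        exact lintegral_min_coord_sq_le hφ 0 hu
    _ = _ := by ring

/-! ### Analysis of the Gaussian transform -/

/-- The Gaussian (Laplace) transform `s ↦ b s + ∫ (1 - exp (-s |x|²)) m(dx)`. -/
noncomputable def gaussTransform {d : ℕ} (m : Measure (EuclideanSpace ℝ (Fin d))) (b s : ℝ) : ℝ :=
  b * s + ∫ x, (1 - Real.exp (-(s * ‖x‖ ^ 2))) ∂m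

theorem one_sub_exp_neg_le_min {z : ℝ} : 1 - Real.exp (-z) ≤ min 1 z :=
  le_min (by linarith [Real.exp_pos (-z)]) (by linarith [Real.add_one_le_exp (-z)])

theorem min_le_two_mul_one_sub_exp_neg {z : ℝ} (hz : 0 ≤ z) :
    min 1 z ≤ 2 * (1 - Real.exp (-z)) := by
  have h1 : (1 + z) * Real.exp (-z) ≤ 1 := by
    have := Real.add_one_le_exp z
    calc (1 + z) * Real.exp (-z) ≤ Real.exp z * Real.exp (-z) := by
          gcongr; linarith
      _ = 1 := by rw [← Real.exp_add]; simp
  rcases le_total z 1 with h | h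
  · rw [min_eq_right h]
    have := Real.exp_pos (-z)
    nlinarith
  · rw [min_eq_left h]
    have := Real.exp_pos (-z)
    nlinarith

/-- Bernoulli's inequality for `(exp (-z)) ^ l`; it yields the sublinearity `gaussTransform_mul_le`.
-/
theorem one_sub_exp_neg_mul_le {l z : ℝ} (hl : 1 ≤ l) :
    1 - Real.exp (-(l * z)) ≤ l * (1 - Real.exp (-z)) := by
  have := one_add_mul_self_le_rpow_one_add (s := Real.exp (-z) - 1)
    (by linarith [Real.exp_pos (-z)]) hl
  rw [add_sub_cancel, ← Real.exp_mul] at this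
  rw [show -(l * z) = -z * l by ring]
  linarith

section

variable {d : ℕ} {m : Measure (EuclideanSpace ℝ (Fin d))} {b s : ℝ}

theorem integrable_min_const_mul (hm : Integrable (fun x => min (‖x‖ ^ 2) 1) m) (hs : 0 ≤ s) :
    Integrable (fun x => min 1 (s * ‖x‖ ^ 2)) m := by
  refine (hm.const_mul (1 + s)).mono' (by fun_prop) (ae_of_all _ fun x => ?_)
  have hx := sq_nonneg ‖x‖
  rw [Real.norm_of_nonneg (by positivity)]
  rcases le_total (‖x‖ ^ 2) 1 with h | h
  · rw [min_eq_left h]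
    exact (min_le_right _ _).trans (by nlinarith)
  · rw [min_eq_right h]
    exact (min_le_left _ _).trans (by nlinarith)

theorem integrable_one_sub_exp (hm : Integrable (fun x => min (‖x‖ ^ 2) 1) m) (hs : 0 ≤ s) :
    Integrable (fun x => 1 - Real.exp (-(s * ‖x‖ ^ 2))) m := by
  refine (integrable_min_const_mul hm hs).mono' (by fun_prop) (ae_of_all _ fun x => ?_)
  rw [Real.norm_of_nonneg]
  · exact one_sub_exp_neg_le_min
  · have : Real.exp (-(s * ‖x‖ ^ 2)) ≤ 1 := Real.exp_le_one_iff.2 (by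
      have := mul_nonneg hs (sq_nonneg ‖x‖); linarith)
    linarith

theorem measure_norm_ge_ne_top (hm : Integrable (fun x => min (‖x‖ ^ 2) 1) m) {ε : ℝ}
    (hε : 0 < ε) : m {x | ε ≤ ‖x‖} ≠ ∞ := by
  have h := hm.measure_norm_ge_lt_top (ε := min (ε ^ 2) 1) (by positivity)
  refine ne_top_of_le_ne_top h.ne (measure_mono fun x hx => ?_)
  have hx' : ε ≤ ‖x‖ := hx
  simp only [Set.mem_ofPred_eq]
  rw [Real.norm_of_nonneg (by positivity)]
  gcongr

theorem gaussTransform_nonneg (hb : 0 ≤ b) (hs : 0 ≤ s) : 0 ≤ gaussTransform m b s := by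
  refine add_nonneg (mul_nonneg hb hs) (integral_nonneg fun x => ?_)
  have : Real.exp (-(s * ‖x‖ ^ 2)) ≤ 1 := Real.exp_le_one_iff.2 (by
      have := mul_nonneg hs (sq_nonneg ‖x‖); linarith)
  simp only [Pi.zero_apply]
  linarith

theorem gaussTransform_mono (hm : Integrable (fun x => min (‖x‖ ^ 2) 1) m) (hb : 0 ≤ b)
    (hs : 0 ≤ s) {s' : ℝ} (h : s ≤ s') : gaussTransform m b s ≤ gaussTransform m b s' := by
  refine add_le_add (by gcongr) (integral_mono (integrable_one_sub_exp hm hs)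
    (integrable_one_sub_exp hm (hs.trans h)) fun x => ?_)
  have := mul_le_mul_of_nonneg_right h (sq_nonneg ‖x‖)
  have := Real.exp_le_exp.2 (neg_le_neg this)
  simp only
  linarith

theorem gaussTransform_mul_le (hm : Integrable (fun x => min (‖x‖ ^ 2) 1) m)
    (hs : 0 ≤ s) {l : ℝ} (hl : 1 ≤ l) : gaussTransform m b (l * s) ≤ l * gaussTransform m b s := by
  have h0 : 0 ≤ l := by linarith
  rw [gaussTransform, gaussTransform, mul_add, ← integral_const_mul]
  refine add_le_add (by linarith) (integral_mono (integrable_one_sub_exp hm (by positivity))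
    ((integrable_one_sub_exp hm hs).const_mul _) fun x => ?_)
  simp only [mul_assoc]
  exact one_sub_exp_neg_mul_le hl

/-- The bound is pointwise in `x`. Near the origin `1 - exp (-s|x|²) ≤ s|x|²`, which is `1/K` times
a quantity below 1 that the transform at `K s` sees up to a factor 2. Far away the integrand is at
most 1, and so is `2 (1 - exp (-(s/L)|x|²))` at least 1. In between, 1 is paid by the annulus. -/
theorem gaussTransform_le_add_annulus (hm : Integrable (fun x => min (‖x‖ ^ 2) 1) m)
    (hb : 0 ≤ b) (hs : 0 < s) {K L : ℝ} (hK : 1 ≤ K) (hL : 1 ≤ L) :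
    gaussTransform m b s ≤ 2 / K * gaussTransform m b (K * s) +
      m.real {x | 1 ≤ K * s * ‖x‖ ^ 2 ∧ s / L * ‖x‖ ^ 2 ≤ 1} +
      2 * gaussTransform m b (s / L) := by
  have hK0 : 0 < K := by linarith
  have hL0 : 0 < L := by linarith
  set A := {x : EuclideanSpace ℝ (Fin d) | 1 ≤ K * s * ‖x‖ ^ 2 ∧ s / L * ‖x‖ ^ 2 ≤ 1} with hA
  have hAm : MeasurableSet A := by
    exact (measurableSet_le (f := fun _ => (1 : ℝ)) (g := fun x => K * s * ‖x‖ ^ 2)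
      (by fun_prop) (by fun_prop)).inter (measurableSet_le (f := fun x => s / L * ‖x‖ ^ 2)
        (g := fun _ => (1 : ℝ)) (by fun_prop) (by fun_prop))
  have hAfin : m A ≠ ∞ := by
    refine ne_top_of_le_ne_top (measure_norm_ge_ne_top hm
      (ε := 1 / √(K * s)) (by positivity)) (measure_mono fun x hx => ?_)
    simp only [Set.mem_ofPred_eq]
    rw [div_le_iff₀ (by positivity)]
    refine (sq_le_sq₀ zero_le_one (by positivity)).1 ?_
    rw [mul_pow, Real.sq_sqrt (by positivity)]
    have := hx.1
    linarith
  have hI := integrable_one_sub_exp hm hs.le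
  have hIK := integrable_one_sub_exp hm (s := K * s) (by positivity)
  have hIL := integrable_one_sub_exp hm (s := s / L) (by positivity)
  have hind : Integrable (A.indicator (fun _ => (1 : ℝ))) m :=
    (integrable_indicator_iff hAm).2 (by
      rw [integrableOn_const_iff]; right; exact hAfin.lt_top)
  have hint : ∫ x, (1 - Real.exp (-(s * ‖x‖ ^ 2))) ∂m ≤
      ∫ x, (2 / K * (1 - Real.exp (-(K * s * ‖x‖ ^ 2))) + A.indicator (fun _ => (1 : ℝ)) x +
        2 * (1 - Real.exp (-(s / L * ‖x‖ ^ 2)))) ∂m := by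
    refine integral_mono hI (((hIK.const_mul _).add hind).add (hIL.const_mul _)) fun x => ?_
    have hx := sq_nonneg ‖x‖
    have hsx := mul_nonneg hs.le hx
    have e1 : 0 ≤ 1 - Real.exp (-(K * s * ‖x‖ ^ 2)) := by
      have := Real.exp_le_one_iff.2 (show -(K * s * ‖x‖ ^ 2) ≤ 0 by
        rw [neg_nonpos]; positivity)
      linarith
    have e2 : 0 ≤ 1 - Real.exp (-(s / L * ‖x‖ ^ 2)) := by
      have := Real.exp_le_one_iff.2 (show -(s / L * ‖x‖ ^ 2) ≤ 0 by
        rw [neg_nonpos]; positivity)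
      linarith
    have e3 : 0 ≤ A.indicator (fun _ => (1 : ℝ)) x := Set.indicator_nonneg (by simp) x
    have e4 : 0 ≤ 2 / K * (1 - Real.exp (-(K * s * ‖x‖ ^ 2))) := by positivity
    have hle := one_sub_exp_neg_le_min (z := s * ‖x‖ ^ 2)
    by_cases h1 : 1 ≤ K * s * ‖x‖ ^ 2
    · by_cases h2 : s / L * ‖x‖ ^ 2 ≤ 1
      · have : A.indicator (fun _ => (1 : ℝ)) x = 1 :=
          Set.indicator_of_mem (show x ∈ A from ⟨h1, h2⟩) _
        have := hle.trans (min_le_left _ _)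
        simp only
        linarith
      · have h3 := min_le_two_mul_one_sub_exp_neg (z := s / L * ‖x‖ ^ 2) (by positivity)
        rw [min_eq_left (by linarith)] at h3
        have := hle.trans (min_le_left _ _)
        simp only
        linarith
    · have h3 := min_le_two_mul_one_sub_exp_neg (z := K * s * ‖x‖ ^ 2) (by positivity)
      rw [min_eq_right (by linarith)] at h3
      have h4 := hle.trans (min_le_right _ _)
      have h5 : s * ‖x‖ ^ 2 ≤ 2 / K * (1 - Real.exp (-(K * s * ‖x‖ ^ 2))) := by
        rw [div_mul_eq_mul_div, le_div_iff₀ hK0]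
        linarith
      simp only
      linarith
  have hsum : Integrable (fun x => 2 / K * (1 - Real.exp (-(K * s * ‖x‖ ^ 2))) +
      A.indicator (fun _ => (1 : ℝ)) x) m := (hIK.const_mul _).add hind
  rw [integral_add hsum (hIL.const_mul _),
    integral_add (hIK.const_mul _) hind, integral_const_mul, integral_const_mul,
    integral_indicator_const _ hAm] at hint
  simp only [gaussTransform]
  have e : 2 / K * (b * (K * s)) = 2 * (b * s) := by field_simp
  have e' : 0 ≤ b * (s / L) := by positivity
  have e'' : 0 ≤ b * s := by positivity
  simp only [smul_eq_mul, mul_one] at hint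
  nlinarith

/-- With `y = exp (-s|x|²)` the integrands of the two differences are `y - y⁴` and `4(1 - y) - (1 -
y⁴)`. Both are nonnegative on `[0, 1]` and bounded below when `y` stays away from 0 and 1, which is
the case on `A`. -/
theorem gaussTransform_doubling (hm : Integrable (fun x => min (‖x‖ ^ 2) 1) m)
    (hb : 0 ≤ b) (hs : 0 < s) {A : Set (EuclideanSpace ℝ (Fin d))} (hAm : MeasurableSet A)
    (hAfin : m A ≠ ∞) (hA : ∀ x ∈ A, 1 / 4 ≤ s * ‖x‖ ^ 2 ∧ s * ‖x‖ ^ 2 ≤ 1) :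
    m.real A / 10 ≤ gaussTransform m b (4 * s) - gaussTransform m b s ∧
      m.real A / 10 ≤ 4 * gaussTransform m b s - gaussTransform m b (4 * s) := by
  have hI := integrable_one_sub_exp hm hs.le
  have hI4 := integrable_one_sub_exp hm (s := 4 * s) (by positivity)
  have hind : Integrable (A.indicator (fun _ => (1 / 10 : ℝ))) m :=
    (integrable_indicator_iff hAm).2 (by
      rw [integrableOn_const_iff]; right; exact hAfin.lt_top)
  have hindv : ∫ x, A.indicator (fun _ => (1 / 10 : ℝ)) x ∂m = m.real A / 10 := by
    rw [integral_indicator_const _ hAm, smul_eq_mul]; ring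
  have hbs : 0 ≤ b * s := by positivity
  have hexp4 : ∀ x : EuclideanSpace ℝ (Fin d), Real.exp (-(4 * s * ‖x‖ ^ 2)) =
      Real.exp (-(s * ‖x‖ ^ 2)) ^ 4 := by
    intro x
    rw [← Real.exp_nat_mul]; congr 1; push_cast; ring
  have hy0 : ∀ x : EuclideanSpace ℝ (Fin d), 0 < Real.exp (-(s * ‖x‖ ^ 2)) :=
    fun x => Real.exp_pos _
  have hy1 : ∀ x : EuclideanSpace ℝ (Fin d), Real.exp (-(s * ‖x‖ ^ 2)) ≤ 1 :=
    fun x => Real.exp_le_one_iff.2 (by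
      have := mul_nonneg hs.le (sq_nonneg ‖x‖); linarith)
  -- Here `y` lies in `[e⁻¹, e^(-1/4)]`; on `[0.36, 0.8]` both integrands exceed 1/10.
  have hyA : ∀ x ∈ A, 0.36 ≤ Real.exp (-(s * ‖x‖ ^ 2)) ∧ Real.exp (-(s * ‖x‖ ^ 2)) ≤ 0.8 := by
    intro x hx
    obtain ⟨h1, h2⟩ := hA x hx
    constructor
    · refine le_trans ?_ (Real.exp_le_exp.2 (neg_le_neg h2))
      rw [Real.exp_neg, le_inv_comm₀ (by norm_num) (Real.exp_pos _)]
      exact Real.exp_one_lt_d9.le.trans (by norm_num)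
    · refine (Real.exp_le_exp.2 (neg_le_neg h1)).trans ?_
      rw [Real.exp_neg, inv_le_comm₀ (Real.exp_pos _) (by norm_num)]
      have := Real.add_one_le_exp (1 / 4 : ℝ)
      norm_num at this ⊢
      linarith
  constructor
  · have hint : ∫ x, A.indicator (fun _ => (1 / 10 : ℝ)) x ∂m ≤
        ∫ x, ((1 - Real.exp (-(4 * s * ‖x‖ ^ 2))) - (1 - Real.exp (-(s * ‖x‖ ^ 2)))) ∂m := by
      refine integral_mono hind (hI4.sub hI) fun x => ?_
      simp only [hexp4]
      set y := Real.exp (-(s * ‖x‖ ^ 2)) with hy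
      have h0 : 0 < y := hy0 x
      have h1 : y ≤ 1 := hy1 x
      by_cases hx : x ∈ A
      · rw [Set.indicator_of_mem hx]
        obtain ⟨h2, h3⟩ : 0.36 ≤ y ∧ y ≤ 0.8 := hyA x hx
        have h4 : y ^ 3 ≤ 0.8 ^ 3 := by gcongr
        norm_num at h2 h3 h4 ⊢
        nlinarith [mul_le_mul_of_nonneg_left h4 h0.le]
      · rw [Set.indicator_of_notMem hx]
        have := pow_le_of_le_one h0.le h1 (n := 4) (by norm_num)
        linarith
    rw [hindv, integral_sub hI4 hI] at hint
    simp only [gaussTransform]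
    linarith
  · have hint : ∫ x, A.indicator (fun _ => (1 / 10 : ℝ)) x ∂m ≤
        ∫ x, (4 * (1 - Real.exp (-(s * ‖x‖ ^ 2))) - (1 - Real.exp (-(4 * s * ‖x‖ ^ 2)))) ∂m := by
      refine integral_mono hind ((hI.const_mul 4).sub hI4) fun x => ?_
      simp only [hexp4]
      set y := Real.exp (-(s * ‖x‖ ^ 2)) with hy
      have h0 : 0 < y := hy0 x
      have h1 : y ≤ 1 := hy1 x
      have e : 4 * (1 - y) - (1 - y ^ 4) = (1 - y) ^ 2 * (y ^ 2 + 2 * y + 3) := by ring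
      rw [e]
      by_cases hx : x ∈ A
      · rw [Set.indicator_of_mem hx]
        obtain ⟨h2, h3⟩ : 0.36 ≤ y ∧ y ≤ 0.8 := hyA x hx
        have h4 : (0.2 : ℝ) ^ 2 ≤ (1 - y) ^ 2 := by
          gcongr; linarith
        have h5 : 3 ≤ y ^ 2 + 2 * y + 3 := by linarith [sq_nonneg y]
        norm_num at h4 ⊢
        nlinarith
      · rw [Set.indicator_of_notMem hx]
        positivity
    rw [hindv, integral_sub (hI.const_mul 4) hI4, integral_const_mul] at hint
    simp only [gaussTransform]
    linarith

end

/-! ### Density values against the Gaussian transform -/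

/-- The annulus has inner radius `1/(k u) = ‖x‖` and outer radius `l/u`, so the density on it is at
most `f x`. -/
theorem HasUnimodalDensity.gaussTransform_le {d : ℕ} [NeZero d]
    {m : Measure (EuclideanSpace ℝ (Fin d))} {f : EuclideanSpace ℝ (Fin d) → ℝ}
    (h : HasUnimodalDensity m f) (hm : Integrable (fun x => min (‖x‖ ^ 2) 1) m) {b : ℝ}
    (hb : 0 ≤ b) {u k l : ℝ} (hu : 0 < u) (hk : 1 ≤ k) (hl : 1 ≤ l)
    {x : EuclideanSpace ℝ (Fin d)} (hx : ‖x‖ = (k * u)⁻¹) :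
    gaussTransform m b (u ^ 2) ≤ 2 / k ^ 2 * gaussTransform m b ((k * u) ^ 2) +
      f x * ((l / u) ^ d * volume.real (Metric.ball (0 : EuclideanSpace ℝ (Fin d)) 1)) +
      2 * gaussTransform m b ((u / l) ^ 2) := by
  have hk0 : 0 < k := by linarith
  have hl0 : 0 < l := by linarith
  have key := gaussTransform_le_add_annulus hm hb (s := u ^ 2) (by positivity)
    (K := k ^ 2) (L := l ^ 2) (one_le_pow₀ hk) (one_le_pow₀ hl)
  have hA : MeasurableSet {x : EuclideanSpace ℝ (Fin d) |
      1 ≤ k ^ 2 * u ^ 2 * ‖x‖ ^ 2 ∧ u ^ 2 / l ^ 2 * ‖x‖ ^ 2 ≤ 1} :=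
    (measurableSet_le (f := fun _ => (1 : ℝ)) (g := fun x => k ^ 2 * u ^ 2 * ‖x‖ ^ 2)
      (by fun_prop) (by fun_prop)).inter (measurableSet_le (f := fun x => u ^ 2 / l ^ 2 * ‖x‖ ^ 2)
        (g := fun _ => (1 : ℝ)) (by fun_prop) (by fun_prop))
  have hx0 : x ≠ 0 := by
    rw [← norm_pos_iff, hx]; positivity
  have h2 := h.measureReal_le hA hx0 (R := l / u) (by positivity) (by
    rintro y ⟨h1, h2⟩
    constructor
    · rw [hx, inv_le_iff_one_le_mul₀' (by positivity)]
      refine (sq_le_sq₀ zero_le_one (by positivity)).1 ?_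
      rw [mul_pow, mul_pow]
      linarith
    · rw [le_div_iff₀ hu]
      refine (sq_le_sq₀ (by positivity) (by positivity)).1 ?_
      rw [div_mul_eq_mul_div, div_le_one (by positivity)] at h2
      rw [mul_pow]
      linarith)
  rw [mul_pow k u, div_pow u l]
  linarith

theorem HasUnimodalDensity.gaussTransform_doubling {d : ℕ} [NeZero d]
    {m : Measure (EuclideanSpace ℝ (Fin d))} {f : EuclideanSpace ℝ (Fin d) → ℝ}
    (h : HasUnimodalDensity m f) (hm : Integrable (fun x => min (‖x‖ ^ 2) 1) m) {b : ℝ}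
    (hb : 0 ≤ b) {u : ℝ} (hu : 0 < u) {x : EuclideanSpace ℝ (Fin d)} (hx : ‖x‖ = u⁻¹) :
    f x * (‖x‖ ^ d * volume.real (Metric.ball (0 : EuclideanSpace ℝ (Fin d)) 1)) / 20 ≤
        gaussTransform m b ((2 * u) ^ 2) - gaussTransform m b (u ^ 2) ∧
      f x * (‖x‖ ^ d * volume.real (Metric.ball (0 : EuclideanSpace ℝ (Fin d)) 1)) / 20 ≤
        4 * gaussTransform m b (u ^ 2) - gaussTransform m b ((2 * u) ^ 2) := by
  have hx' : 0 < ‖x‖ := by rw [hx]; positivity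
  have hfin : m {y | ‖x‖ / 2 ≤ ‖y‖ ∧ ‖y‖ ≤ ‖x‖} ≠ ∞ :=
    ne_top_of_le_ne_top (measure_norm_ge_ne_top hm (half_pos hx'))
      (measure_mono fun y hy => hy.1)
  have hA : MeasurableSet {y : EuclideanSpace ℝ (Fin d) | ‖x‖ / 2 ≤ ‖y‖ ∧ ‖y‖ ≤ ‖x‖} :=
    ((isClosed_le continuous_const continuous_norm).inter
      (isClosed_le continuous_norm continuous_const)).measurableSet
  have h1 := h.le_measureReal_annulus (norm_pos_iff.1 hx') hfin
  have h2 := _root_.gaussTransform_doubling hm hb (s := u ^ 2) (by positivity) hA hfin (by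
    rintro y ⟨h3, h4⟩
    rw [← mul_pow]
    have e : u * ‖x‖ = 1 := by rw [hx]; field_simp
    have h5 : 1 / 2 ≤ u * ‖y‖ := by nlinarith
    have h6 : u * ‖y‖ ≤ 1 := by nlinarith
    constructor <;> nlinarith)
  rw [show (2 * u) ^ 2 = 4 * u ^ 2 by ring]
  constructor <;> linarith [h2.1, h2.2]

theorem IsLevyMeasure.integrable_min {d : ℕ} {N : Measure (EuclideanSpace ℝ (Fin d))}
    (hN : IsLevyMeasure N) : Integrable (fun x => min (‖x‖ ^ 2) 1) N := by
  refine ⟨by fun_prop, ?_⟩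
  rw [hasFiniteIntegral_iff_ofReal (ae_of_all _ fun x => by positivity)]
  exact hN.lintegral_lt_top

theorem integrable_min_of_isFiniteMeasure {d : ℕ} (m : Measure (EuclideanSpace ℝ (Fin d)))
    [IsFiniteMeasure m] : Integrable (fun x => min (‖x‖ ^ 2) 1) m :=
  (integrable_const (1 : ℝ)).mono' (by fun_prop) (ae_of_all _ fun x => by
    rw [Real.norm_of_nonneg (by positivity)]; exact min_le_right _ _)

/-! ### Gaussian averaging of exponents and characteristic functions -/

theorem one_sub_cos_le_min (a : ℝ) : 1 - Real.cos a ≤ min 2 (a ^ 2 / 2) :=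
  le_min (by linarith [Real.neg_one_le_cos a]) (by linarith [Real.one_sub_sq_div_two_le_cos (x := a)])

theorem integrable_norm_pow_stdGaussian (d n : ℕ) :
    Integrable (fun y => ‖y‖ ^ n) (stdGaussian (EuclideanSpace ℝ (Fin d))) := by
  have := (IsGaussian.memLp_id (stdGaussian (EuclideanSpace ℝ (Fin d))) n (by simp)).integrable_norm_pow'
  simpa using this

theorem one_sub_re_charFun {d : ℕ} (m : Measure (EuclideanSpace ℝ (Fin d)))
    [IsProbabilityMeasure m] (x : EuclideanSpace ℝ (Fin d)) :
    1 - (charFun m x).re = ∫ y, (1 - Real.cos (inner ℝ x y)) ∂m := by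
  have hI : Integrable (fun y => Complex.exp (inner ℝ y x * Complex.I)) m := by
    refine (integrable_const (1 : ℝ)).mono' (by fun_prop) (ae_of_all _ fun y => ?_)
    rw [Complex.norm_exp_ofReal_mul_I]
  have hc : Integrable (fun y => Real.cos (inner ℝ x y)) m :=
    (integrable_const (1 : ℝ)).mono' (by fun_prop) (ae_of_all _ fun y => Real.abs_cos_le_one _)
  rw [charFun_apply, integral_sub (integrable_const _) hc, integral_const, probReal_univ,
    one_smul]
  congr 1
  have := integral_re hI
  simp only [RCLike.re_eq_complex_re] at this
  rw [← this]
  refine integral_congr_ae (ae_of_all _ fun y => ?_)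
  simp only [Complex.exp_ofReal_mul_I_re]
  rw [real_inner_comm]

theorem integral_one_sub_cos_stdGaussian {d : ℕ} (x : EuclideanSpace ℝ (Fin d)) :
    ∫ y, (1 - Real.cos (inner ℝ y x)) ∂(stdGaussian (EuclideanSpace ℝ (Fin d))) =
      1 - Real.exp (-(‖x‖ ^ 2 / 2)) := by
  have h := one_sub_re_charFun (stdGaussian (EuclideanSpace ℝ (Fin d))) x
  simp only [real_inner_comm] at h ⊢
  rw [← h, charFun_stdGaussian]
  congr 1
  rw [show (-(‖x‖ : ℂ) ^ 2 / 2) = ((-(‖x‖ ^ 2 / 2) : ℝ) : ℂ) by push_cast; ring,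
    Complex.exp_ofReal_re]

/-- Fubini and the Gaussian characteristic function; the factor `√2` cancels the 1/2 in `exp
(-|x|²/2)`. Domination of `1 - cos` by `(2 + u²|y|²) min(|x|², 1)` justifies the exchange. -/
theorem integral_integral_one_sub_cos {d : ℕ} {m : Measure (EuclideanSpace ℝ (Fin d))}
    [SFinite m] (hm : Integrable (fun x => min (‖x‖ ^ 2) 1) m) (u : ℝ) :
    Integrable (fun y => ∫ x, (1 - Real.cos (inner ℝ ((√2 * u) • y) x)) ∂m)
      (stdGaussian (EuclideanSpace ℝ (Fin d))) ∧
    ∫ y, ∫ x, (1 - Real.cos (inner ℝ ((√2 * u) • y) x)) ∂m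
      ∂(stdGaussian (EuclideanSpace ℝ (Fin d))) = ∫ x, (1 - Real.exp (-(u ^ 2 * ‖x‖ ^ 2))) ∂m := by
  set γ := stdGaussian (EuclideanSpace ℝ (Fin d)) with hγ
  have h2 : √2 ^ 2 = (2 : ℝ) := Real.sq_sqrt (by norm_num)
  have hint : Integrable (fun z : EuclideanSpace ℝ (Fin d) × EuclideanSpace ℝ (Fin d) =>
      1 - Real.cos (inner ℝ ((√2 * u) • z.1) z.2)) (γ.prod m) := by
    have hy : Integrable (fun y : EuclideanSpace ℝ (Fin d) => 2 + u ^ 2 * ‖y‖ ^ 2) γ :=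
      (integrable_const _).add ((integrable_norm_pow_stdGaussian d 2).const_mul _)
    refine (hy.mul_prod hm).mono' ?_ (ae_of_all _ fun z => ?_)
    · have : Continuous (fun z : EuclideanSpace ℝ (Fin d) × EuclideanSpace ℝ (Fin d) =>
          1 - Real.cos (inner ℝ ((√2 * u) • z.1) z.2)) := by fun_prop
      exact this.aestronglyMeasurable
    · set a : ℝ := inner ℝ ((√2 * u) • z.1) z.2 with ha
      have h1 := one_sub_cos_le_min a
      rw [Real.norm_of_nonneg (by linarith [Real.cos_le_one a])]
      have ha2 : a ^ 2 / 2 ≤ u ^ 2 * ‖z.1‖ ^ 2 * ‖z.2‖ ^ 2 := by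
        have h3 : (inner ℝ z.1 z.2 : ℝ) ^ 2 ≤ (‖z.1‖ * ‖z.2‖) ^ 2 :=
          sq_le_sq.2 ((abs_real_inner_le_norm _ _).trans (le_abs_self _))
        have : a ^ 2 / 2 = u ^ 2 * (inner ℝ z.1 z.2 : ℝ) ^ 2 := by
          rw [ha, real_inner_smul_left, mul_pow, mul_pow, h2]; ring
        rw [mul_pow] at h3
        rw [this, mul_assoc]
        exact mul_le_mul_of_nonneg_left h3 (sq_nonneg u)
      have hz := sq_nonneg ‖z.2‖
      have hz1 : 0 ≤ u ^ 2 * ‖z.1‖ ^ 2 := by positivity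
      rcases le_total (‖z.2‖ ^ 2) 1 with h | h
      · rw [min_eq_left h]
        nlinarith [h1.trans (min_le_right _ _)]
      · rw [min_eq_right h]
        nlinarith [h1.trans (min_le_left _ _)]
  refine ⟨hint.integral_prod_left, ?_⟩
  rw [integral_integral_swap hint]
  refine integral_congr_ae (ae_of_all _ fun x => ?_)
  have h := integral_one_sub_cos_stdGaussian ((√2 * u) • x)
  simp only [real_inner_smul_left, inner_smul_right] at h ⊢
  rw [h, norm_smul, mul_pow, Real.norm_eq_abs, sq_abs, mul_pow, h2]
  congr 3
  ring

/-- Testing against one unit vector bounds the second moment below by `1 - exp (-1/2)`. Positivity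
lets the coefficient `b = 2Kσ` control `σ`. -/
theorem integral_norm_sq_stdGaussian_pos (d : ℕ) [NeZero d] :
    0 < ∫ y, ‖y‖ ^ 2 ∂(stdGaussian (EuclideanSpace ℝ (Fin d))) := by
  set γ := stdGaussian (EuclideanSpace ℝ (Fin d)) with hγ
  set e : EuclideanSpace ℝ (Fin d) := EuclideanSpace.single 0 1 with he
  have hnorm : ‖e‖ = 1 := by simp [he]
  have h1 := integral_one_sub_cos_stdGaussian e
  rw [hnorm] at h1
  have h2 : ∫ y, (1 - Real.cos (inner ℝ y e)) ∂γ ≤ ∫ y, ‖y‖ ^ 2 ∂γ := by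
    refine integral_mono_of_nonneg (ae_of_all _ fun y => by
      simp only [Pi.zero_apply]; linarith [Real.cos_le_one (inner ℝ y e)])
      (integrable_norm_pow_stdGaussian d 2) (ae_of_all _ fun y => ?_)
    have h3 := (one_sub_cos_le_min (inner ℝ y e)).trans (min_le_right _ _)
    have h4 : (inner ℝ y e : ℝ) ^ 2 ≤ ‖y‖ ^ 2 :=
      sq_le_sq.2 (((abs_real_inner_le_norm _ _).trans (by rw [hnorm, mul_one])).trans
        (le_abs_self _))
    simp only
    nlinarith [sq_nonneg ‖y‖]
  have h5 : Real.exp (-((1 : ℝ) ^ 2 / 2)) < 1 := Real.exp_lt_one_iff.2 (by norm_num)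
  linarith

section

variable {d : ℕ} {N : Measure (EuclideanSpace ℝ (Fin d))} {ψ : EuclideanSpace ℝ (Fin d) → ℝ}
  {σ : ℝ}

theorem integral_comp_smul_stdGaussian [SFinite N]
    (hm : Integrable (fun x => min (‖x‖ ^ 2) 1) N)
    (hψ : ∀ ξ, ψ ξ = σ * ‖ξ‖ ^ 2 + ∫ x, (1 - Real.cos (inner ℝ ξ x)) ∂N) (u : ℝ) :
    Integrable (fun y => ψ ((√2 * u) • y)) (stdGaussian (EuclideanSpace ℝ (Fin d))) ∧
    ∫ y, ψ ((√2 * u) • y) ∂(stdGaussian (EuclideanSpace ℝ (Fin d))) =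
      gaussTransform N (2 * (∫ y, ‖y‖ ^ 2 ∂(stdGaussian (EuclideanSpace ℝ (Fin d)))) * σ)
        (u ^ 2) := by
  obtain ⟨h1, h2⟩ := integral_integral_one_sub_cos hm u
  have h3 : Integrable (fun y => σ * ‖(√2 * u) • y‖ ^ 2)
      (stdGaussian (EuclideanSpace ℝ (Fin d))) := by
    simp only [norm_smul, mul_pow]
    exact ((integrable_norm_pow_stdGaussian d 2).const_mul _).const_mul _
  have h4 : (fun y => ψ ((√2 * u) • y)) = fun y => σ * ‖(√2 * u) • y‖ ^ 2 +
      ∫ x, (1 - Real.cos (inner ℝ ((√2 * u) • y) x)) ∂N := funext fun y => hψ _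
  rw [h4]
  refine ⟨h3.add h1, ?_⟩
  rw [integral_add h3 h1, h2, gaussTransform]
  congr 1
  simp only [norm_smul, mul_pow, integral_const_mul, Real.norm_eq_abs, sq_abs]
  rw [Real.sq_sqrt (by norm_num)]
  ring

theorem exponent_nonneg (hσ : 0 ≤ σ)
    (hψ : ∀ ξ, ψ ξ = σ * ‖ξ‖ ^ 2 + ∫ x, (1 - Real.cos (inner ℝ ξ x)) ∂N)
    (ξ : EuclideanSpace ℝ (Fin d)) : 0 ≤ ψ ξ := by
  rw [hψ]
  exact add_nonneg (by positivity) (integral_nonneg fun x => by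
    simp only [Pi.zero_apply]; linarith [Real.cos_le_one (inner ℝ ξ x)])

theorem integrable_one_sub_cos (hm : Integrable (fun x => min (‖x‖ ^ 2) 1) N)
    (ξ : EuclideanSpace ℝ (Fin d)) : Integrable (fun x => 1 - Real.cos (inner ℝ ξ x)) N := by
  refine ((integrable_min_const_mul hm (sq_nonneg ‖ξ‖)).const_mul 2).mono' (by fun_prop)
    (ae_of_all _ fun x => ?_)
  rw [Real.norm_of_nonneg (by linarith [Real.cos_le_one (inner ℝ ξ x)])]
  have h1 := one_sub_cos_le_min (inner ℝ ξ x)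
  have h3 : (inner ℝ ξ x : ℝ) ^ 2 ≤ (‖ξ‖ * ‖x‖) ^ 2 :=
    sq_le_sq.2 ((abs_real_inner_le_norm _ _).trans (le_abs_self _))
  rw [mul_pow] at h3
  have h4 : 0 ≤ ‖ξ‖ ^ 2 * ‖x‖ ^ 2 := by positivity
  rcases le_total 1 (‖ξ‖ ^ 2 * ‖x‖ ^ 2) with h | h
  · rw [min_eq_left h]; linarith [h1.trans (min_le_left _ _)]
  · rw [min_eq_right h]; linarith [h1.trans (min_le_right _ _)]

theorem exponent_le_gaussTransform (hm : Integrable (fun x => min (‖x‖ ^ 2) 1) N)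
    (hψ : ∀ ξ, ψ ξ = σ * ‖ξ‖ ^ 2 + ∫ x, (1 - Real.cos (inner ℝ ξ x)) ∂N) {K : ℝ} (hK : 0 < K)
    (hσ : 0 ≤ σ) (ξ : EuclideanSpace ℝ (Fin d)) :
    ψ ξ ≤ (4 + (2 * K)⁻¹) * gaussTransform N (2 * K * σ) (‖ξ‖ ^ 2) := by
  have h1 : ∫ x, (1 - Real.cos (inner ℝ ξ x)) ∂N ≤
      4 * ∫ x, (1 - Real.exp (-(‖ξ‖ ^ 2 * ‖x‖ ^ 2))) ∂N := by
    rw [← integral_const_mul]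
    refine integral_mono (integrable_one_sub_cos hm ξ)
      ((integrable_one_sub_exp hm (sq_nonneg ‖ξ‖)).const_mul 4) fun x => ?_
    have h1 := one_sub_cos_le_min (inner ℝ ξ x)
    have h3 : (inner ℝ ξ x : ℝ) ^ 2 ≤ (‖ξ‖ * ‖x‖) ^ 2 :=
      sq_le_sq.2 ((abs_real_inner_le_norm _ _).trans (le_abs_self _))
    rw [mul_pow] at h3
    have h4 : 0 ≤ ‖ξ‖ ^ 2 * ‖x‖ ^ 2 := by positivity
    have h5 := min_le_two_mul_one_sub_exp_neg h4
    simp only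
    rcases le_total 1 (‖ξ‖ ^ 2 * ‖x‖ ^ 2) with h | h
    · rw [min_eq_left h] at h5; linarith [h1.trans (min_le_left _ _)]
    · rw [min_eq_right h] at h5; linarith [h1.trans (min_le_right _ _)]
  have h2 : 0 ≤ ∫ x, (1 - Real.exp (-(‖ξ‖ ^ 2 * ‖x‖ ^ 2))) ∂N := by
    have := gaussTransform_nonneg (m := N) le_rfl (sq_nonneg ‖ξ‖)
    simpa [gaussTransform] using this
  have h3 : σ * ‖ξ‖ ^ 2 = (2 * K)⁻¹ * (2 * K * σ * ‖ξ‖ ^ 2) := by field_simp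
  have h4 : 0 ≤ 2 * K * σ * ‖ξ‖ ^ 2 := by positivity
  have h5 : 0 ≤ (2 * K)⁻¹ := by positivity
  rw [hψ, h3, gaussTransform]
  nlinarith [mul_nonneg h5 h2]

/-- This is the half of the comparison that needs unimodality; it rests on
`lintegral_min_norm_sq_le`. -/
theorem gaussTransform_le_radialProfile [NeZero d] {ν : EuclideanSpace ℝ (Fin d) → ℝ}
    (hN : IsLevyMeasure N) (hν : HasUnimodalDensity N ν)
    (hψ : ∀ ξ, ψ ξ = σ * ‖ξ‖ ^ 2 + ∫ x, (1 - Real.cos (inner ℝ ξ x)) ∂N) {K : ℝ} (hK : 0 < K)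
    (hσ : 0 ≤ σ) {u : ℝ} (hu : 0 < u) :
    gaussTransform N (2 * K * σ) (u ^ 2) ≤ (2 * K + 7 * d) * radialProfile ψ u := by
  have hm := hN.integrable_min
  obtain ⟨φ, hφ, hNφ⟩ := hν.exists_antitone hN.zero
  have h1 := lintegral_min_norm_sq_le (d := d) hφ hu
  rw [← hNφ] at h1
  have hin : ∀ x : EuclideanSpace ℝ (Fin d),
      inner ℝ (EuclideanSpace.single 0 u : EuclideanSpace ℝ (Fin d)) x = u * x 0 := fun x => by
    simp [EuclideanSpace.inner_single_left]
  have hI := integrable_one_sub_cos hm (EuclideanSpace.single 0 u : EuclideanSpace ℝ (Fin d))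
  simp only [hin] at hI
  have hI' := integrable_min_const_mul hm (sq_nonneg u)
  rw [← ofReal_integral_eq_lintegral_ofReal hI' (ae_of_all _ fun x => by positivity),
    ← ofReal_integral_eq_lintegral_ofReal hI (ae_of_all _ fun x => by
      simp only [Pi.zero_apply]; linarith [Real.cos_le_one (u * x 0)]),
    show (7 * d : ℝ≥0∞) = ENNReal.ofReal (7 * d) by
      rw [ENNReal.ofReal_mul (by norm_num)]; simp,
    ← ENNReal.ofReal_mul (by positivity)] at h1
  have hJ : 0 ≤ ∫ x : EuclideanSpace ℝ (Fin d), (1 - Real.cos (u * x 0)) ∂N :=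
    integral_nonneg fun x => by
      simp only [Pi.zero_apply]; linarith [Real.cos_le_one (u * x 0)]
  have h2 := (ENNReal.ofReal_le_ofReal_iff (by positivity)).1 h1
  have h3 : ∫ x, (1 - Real.exp (-(u ^ 2 * ‖x‖ ^ 2))) ∂N ≤
      ∫ x, min 1 (u ^ 2 * ‖x‖ ^ 2) ∂N :=
    integral_mono (integrable_one_sub_exp hm (sq_nonneg u)) hI' fun x => one_sub_exp_neg_le_min
  rw [gaussTransform, radialProfile, hψ]
  simp only [hin]
  have hn : ‖(EuclideanSpace.single 0 u : EuclideanSpace ℝ (Fin d))‖ = u := by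
    simp [abs_of_pos hu]
  rw [hn]
  have h6 : 0 ≤ σ * u ^ 2 := by positivity
  have hd : (0 : ℝ) ≤ d := by positivity
  nlinarith [mul_nonneg hd h6, mul_nonneg hK.le hJ]

theorem gaussTransform_sq_mul_le {b : ℝ} (hm : Integrable (fun x => min (‖x‖ ^ 2) 1) N)
    (hb : 0 ≤ b) (l u : ℝ) :
    gaussTransform N b ((l * u) ^ 2) ≤ (1 + l ^ 2) * gaussTransform N b (u ^ 2) := by
  rw [mul_pow]
  have h0 := gaussTransform_nonneg (m := N) hb (sq_nonneg u)
  rcases le_total 1 (l ^ 2) with h | h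
  · exact (gaussTransform_mul_le hm (sq_nonneg u) h).trans (by linarith)
  · refine (gaussTransform_mono hm hb (by positivity)
      (mul_le_of_le_one_left (sq_nonneg u) h)).trans ?_
    nlinarith [mul_nonneg (sq_nonneg l) h0]

theorem gaussTransform_eq_integral_of_charFun {μ : Measure (EuclideanSpace ℝ (Fin d))}
    [IsProbabilityMeasure μ] {t : ℝ}
    (hμ : ∀ ξ, charFun μ ξ = Complex.exp (-(t * ψ ξ : ℝ))) (u : ℝ) :
    Integrable (fun y => 1 - Real.exp (-(t * ψ ((√2 * u) • y))))
      (stdGaussian (EuclideanSpace ℝ (Fin d))) ∧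
    gaussTransform μ 0 (u ^ 2) = ∫ y, (1 - Real.exp (-(t * ψ ((√2 * u) • y))))
      ∂(stdGaussian (EuclideanSpace ℝ (Fin d))) := by
  have h1 : ∀ ξ, 1 - Real.exp (-(t * ψ ξ)) = ∫ x, (1 - Real.cos (inner ℝ ξ x)) ∂μ := by
    intro ξ
    rw [← one_sub_re_charFun, hμ, ← Complex.ofReal_neg, Complex.exp_ofReal_re]
  obtain ⟨h2, h3⟩ := integral_integral_one_sub_cos (integrable_min_of_isFiniteMeasure μ) u
  simp only [h1]
  refine ⟨h2, ?_⟩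
  rw [h3, gaussTransform, zero_mul, zero_add]

end

/-- Replace `z` by `k z ≤ z` and expand to second order. A small `k` keeps the bound useful for `z`
of order 1, while `k = 1` gives the sharp slope as `z → 0`. -/
theorem one_sub_exp_neg_ge {z k : ℝ} (hz : 0 ≤ z) (hk : 0 ≤ k) (hk1 : k ≤ 1) :
    k * z - k ^ 2 * z ^ 2 ≤ 1 - Real.exp (-z) := by
  have h1 : Real.exp (-z) ≤ Real.exp (-(k * z)) := Real.exp_le_exp.2 (by nlinarith)
  have hw : 0 ≤ k * z := mul_nonneg hk hz
  set w := k * z with hwdef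
  have h2 : Real.exp (-w) ≤ 1 - w + w ^ 2 := by
    have h3 := Real.add_one_le_exp w
    have h4 : Real.exp (-w) * Real.exp w = 1 := by rw [← Real.exp_add]; simp
    have h5 : Real.exp (-w) * (w + 1) ≤ 1 := by
      exact (mul_le_mul_of_nonneg_left h3 (Real.exp_pos _).le).trans h4.le
    have h6 : 1 ≤ (1 - w + w ^ 2) * (w + 1) := by
      have : 0 ≤ w ^ 3 := by positivity
      nlinarith
    exact le_of_mul_le_mul_right (h5.trans h6) (by linarith)
  have : k ^ 2 * z ^ 2 = w ^ 2 := by rw [hwdef]; ring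
  linarith

section

variable {d : ℕ} {N : Measure (EuclideanSpace ℝ (Fin d))} {ψ : EuclideanSpace ℝ (Fin d) → ℝ}
  {σ : ℝ}

/-- The Gaussian transform `G` of the Lévy measure controls the exponent, and also the Gaussian
transforms of the one-dimensional distributions. -/
theorem exists_gaussTransform_comparison [NeZero d] {ν : EuclideanSpace ℝ (Fin d) → ℝ}
    (hN : IsLevyMeasure N) (hν : HasUnimodalDensity N ν) (hσ : 0 ≤ σ)
    (hψ : ∀ ξ, ψ ξ = σ * ‖ξ‖ ^ 2 + ∫ x, (1 - Real.cos (inner ℝ ξ x)) ∂N) :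
    ∃ b C : ℝ, 0 ≤ b ∧ 1 ≤ C ∧
      (∀ ξ, ψ ξ ≤ C * gaussTransform N b (‖ξ‖ ^ 2)) ∧
      (∀ u, 0 < u → gaussTransform N b (u ^ 2) ≤ C * radialProfile ψ u) ∧
      ∀ (t : ℝ≥0) (μ : Measure (EuclideanSpace ℝ (Fin d))), IsProbabilityMeasure μ →
        (∀ ξ, charFun μ ξ = Complex.exp (-((t : ℝ) * ψ ξ : ℝ))) → ∀ u,
        gaussTransform μ 0 (u ^ 2) ≤ t * gaussTransform N b (u ^ 2) ∧
        ∀ k, 0 ≤ k → k ≤ 1 →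
          k * (t * gaussTransform N b (u ^ 2)) - k ^ 2 * C * (t * gaussTransform N b (u ^ 2)) ^ 2 ≤
            gaussTransform μ 0 (u ^ 2) := by
  have hm := hN.integrable_min
  obtain ⟨φ, hφ, hNφ⟩ := hν.exists_antitone hN.zero
  have : SFinite N := by rw [hNφ]; infer_instance
  set γ := stdGaussian (EuclideanSpace ℝ (Fin d)) with hγ
  set K := ∫ y, ‖y‖ ^ 2 ∂γ with hKdef
  have hK : 0 < K := integral_norm_sq_stdGaussian_pos d
  set C₁ := 4 + (2 * K)⁻¹ with hC₁
  set M := ∫ y, (1 + 2 * ‖y‖ ^ 2) ^ 2 ∂γ with hM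
  have hMint : Integrable (fun y => (1 + 2 * ‖y‖ ^ 2) ^ 2) γ := by
    have : (fun y : EuclideanSpace ℝ (Fin d) => (1 + 2 * ‖y‖ ^ 2) ^ 2) =
        fun y => 1 + 4 * ‖y‖ ^ 2 + 4 * ‖y‖ ^ 4 := by ext y; ring
    rw [this]
    exact ((integrable_const _).add ((integrable_norm_pow_stdGaussian d 2).const_mul _)).add
      ((integrable_norm_pow_stdGaussian d 4).const_mul _)
  have hM0 : 0 ≤ M := integral_nonneg fun y => by positivity
  have hC₁0 : 0 < C₁ := by positivity
  set b := 2 * K * σ with hb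
  have hb0 : 0 ≤ b := by positivity
  have hG : ∀ u, 0 ≤ gaussTransform N b (u ^ 2) := fun u =>
    gaussTransform_nonneg hb0 (sq_nonneg u)
  set C := 1 + C₁ + (2 * K + 7 * d) + C₁ ^ 2 * M with hC
  have hd : (0 : ℝ) ≤ d := by positivity
  have hCM : 0 ≤ C₁ ^ 2 * M := by positivity
  have hψ0 := exponent_nonneg hσ hψ
  refine ⟨b, C, hb0, by linarith, fun ξ => ?_, fun u hu => ?_, fun t μ hμ hch u => ?_⟩
  · refine (exponent_le_gaussTransform hm hψ hK hσ ξ).trans ?_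
    exact mul_le_mul_of_nonneg_right (by linarith) (hG _)
  · refine (gaussTransform_le_radialProfile hN hν hψ hK hσ hu).trans ?_
    exact mul_le_mul_of_nonneg_right (by linarith) (hψ0 _)
  · obtain ⟨h1, h2⟩ := integral_comp_smul_stdGaussian hm hψ u
    obtain ⟨h3, h4⟩ := gaussTransform_eq_integral_of_charFun hch u
    rw [← hγ] at h1 h2 h3 h4
    rw [← hKdef, ← hb] at h2
    set g := gaussTransform N b (u ^ 2) with hg
    have hg0 : 0 ≤ g := hG u
    rw [h4]
    constructor
    · rw [← h2, ← integral_const_mul]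
      exact integral_mono h3 (h1.const_mul _) fun y =>
        one_sub_exp_neg_le_min.trans (min_le_right _ _)
    · intro k hk hk1
      -- Quadratic growth in `y` makes the second-order term integrable against the Gaussian, with
      -- the fourth-moment constant `M`.
      have hb1 : ∀ y, ψ ((√2 * u) • y) ≤ C₁ * (1 + 2 * ‖y‖ ^ 2) * g := by
        intro y
        refine (exponent_le_gaussTransform hm hψ hK hσ _).trans ?_
        rw [← hC₁, mul_assoc C₁]
        refine mul_le_mul_of_nonneg_left ?_ hC₁0.le
        have e : ‖(√2 * u) • y‖ ^ 2 = ((√2 * ‖y‖) * u) ^ 2 := by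
          rw [norm_smul, Real.norm_eq_abs, mul_pow, sq_abs]; ring
        rw [e]
        refine (gaussTransform_sq_mul_le hm hb0 _ _).trans (le_of_eq ?_)
        rw [mul_pow, Real.sq_sqrt (by norm_num)]
      have hint : ∫ y, (k * t * ψ ((√2 * u) • y) -
          k ^ 2 * t ^ 2 * C₁ ^ 2 * g ^ 2 * (1 + 2 * ‖y‖ ^ 2) ^ 2) ∂γ ≤
          ∫ y, (1 - Real.exp (-(t * ψ ((√2 * u) • y)))) ∂γ := by
        refine integral_mono ((h1.const_mul _).sub (hMint.const_mul _)) h3 fun y => ?_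
        have h5 := one_sub_exp_neg_ge (z := t * ψ ((√2 * u) • y))
          (mul_nonneg t.2 (hψ0 _)) hk hk1
        have h6 : ψ ((√2 * u) • y) ^ 2 ≤ (C₁ * (1 + 2 * ‖y‖ ^ 2) * g) ^ 2 :=
          pow_le_pow_left₀ (hψ0 _) (hb1 y) 2
        have h7 := mul_le_mul_of_nonneg_left h6
          (show 0 ≤ k ^ 2 * (t : ℝ) ^ 2 by positivity)
        simp only
        nlinarith
      rw [integral_sub (h1.const_mul _) (hMint.const_mul _), integral_const_mul,
        integral_const_mul, h2, ← hM] at hint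
      have h8 : C₁ ^ 2 * M ≤ C := by linarith
      have h9 := mul_le_mul_of_nonneg_left h8 (show 0 ≤ k ^ 2 * ((t : ℝ) * g) ^ 2 by positivity)
      nlinarith

end

/-! ### From dyadic growth to weak scaling -/

theorem two_rpow_logb {a : ℝ} (ha : 0 < a) : (2 : ℝ) ^ Real.logb 2 a = a :=
  Real.rpow_logb (by norm_num) (by norm_num) ha

/-- A function comparable with a monotone `G` whose increments over dyadic intervals are
nondegenerate satisfies both weak scaling conditions. -/
theorem scaling_of_doubling {g G : ℝ → ℝ} {C c θ : ℝ} (hC : 1 ≤ C) (hc : 0 < c) (hc1 : c ≤ 1)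
    (hθ : 0 ≤ θ) (hG0 : ∀ u, 0 ≤ G u) (hmono : ∀ u v, 0 ≤ u → u ≤ v → G u ≤ G v)
    (hgG : ∀ u, 0 < u → g u ≤ C * G u) (hGg : ∀ u, 0 < u → G u ≤ C * g u)
    (hlow : ∀ u, θ < u → c * G u ≤ G (2 * u) - G u)
    (hup : ∀ u, θ < u → c * G u ≤ 4 * G u - G (2 * u)) :
    (∃ α c', 0 < α ∧ α < 2 ∧ 0 < c' ∧ c' ≤ 1 ∧ WLSC g α θ c') ∧
      ∃ β C', 0 < β ∧ β < 2 ∧ 1 ≤ C' ∧ WUSC g β θ C' := by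
  have hC0 : 0 < C := by linarith
  have hpow : ∀ (n : ℕ) (u : ℝ), θ < u → θ < 2 ^ n * u := by
    intro n u hu
    have : (1 : ℝ) ≤ 2 ^ n := one_le_pow₀ (by norm_num)
    nlinarith
  have hL : ∀ (n : ℕ) (u : ℝ), θ < u → (1 + c) ^ n * G u ≤ G (2 ^ n * u) := by
    intro n
    induction n with
    | zero => intro u _; simp
    | succ n ih =>
      intro u hu
      have h1 := ih u hu
      have h2 := hlow _ (hpow n u hu)
      rw [← mul_assoc, ← pow_succ'] at h2
      rw [pow_succ (1 + c)]
      nlinarith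
  have hU : ∀ (n : ℕ) (u : ℝ), θ < u → G (2 ^ n * u) ≤ (4 - c) ^ n * G u := by
    intro n
    induction n with
    | zero => intro u _; simp
    | succ n ih =>
      intro u hu
      have h1 := ih u hu
      have h2 := hup _ (hpow n u hu)
      rw [← mul_assoc, ← pow_succ'] at h2
      rw [pow_succ (4 - c)]
      nlinarith [mul_le_mul_of_nonneg_left h1 (show 0 ≤ 4 - c by linarith)]
  constructor
  -- Rounding `lam` down to a power of 2 loses a factor `1 + c ≤ 2`; passing between `g` and `G`
  -- twice loses `C²`.
  · refine ⟨Real.logb 2 (1 + c), (2 * C ^ 2)⁻¹, Real.logb_pos (by norm_num) (by linarith), ?_,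
      by positivity, inv_le_one_of_one_le₀ (by nlinarith), ?_⟩
    · rw [Real.logb_lt_iff_lt_rpow (by norm_num) (by linarith)]
      norm_num
      linarith
    · intro lam u hlam hu
      set α := Real.logb 2 (1 + c) with hα
      have h2α : (2 : ℝ) ^ α = 1 + c := two_rpow_logb (by linarith)
      have hα0 : 0 < α := Real.logb_pos (by norm_num) (by linarith)
      have hu0 : 0 < u := by linarith
      have hlu : 0 < lam * u := by positivity
      obtain ⟨n, hn1, hn2⟩ := exists_nat_pow_near hlam (by norm_num : (1 : ℝ) < 2)
      have h1 : lam ^ α ≤ 2 * (1 + c) ^ n := by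
        calc lam ^ α ≤ ((2 : ℝ) ^ (n + 1)) ^ α := by gcongr
          _ = (1 + c) ^ (n + 1) := by
            rw [← Real.rpow_pow_comm (by norm_num), h2α]
          _ ≤ 2 * (1 + c) ^ n := by
            rw [pow_succ, mul_comm]; gcongr; linarith
      have h2 : (1 + c) ^ n * G u ≤ G (lam * u) :=
        (hL n u hu).trans (hmono _ _ (by positivity) (by gcongr))
      have h3 := hGg _ hlu
      have h4 := hgG u hu0
      have h5 : lam ^ α * G u ≤ 2 * (C * g (lam * u)) :=
        calc lam ^ α * G u ≤ 2 * (1 + c) ^ n * G u := mul_le_mul_of_nonneg_right h1 (hG0 u)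
          _ ≤ 2 * (C * g (lam * u)) := by linarith
      have h6 : 0 ≤ lam ^ α := by positivity
      rw [mul_assoc, inv_mul_le_iff₀ (by positivity)]
      nlinarith [mul_le_mul_of_nonneg_left h4 h6]
  -- Rounding `lam` up costs a factor `4 - c ≤ 4`.
  · refine ⟨Real.logb 2 (4 - c), 4 * C ^ 2, Real.logb_pos (by norm_num) (by linarith), ?_,
      by nlinarith, ?_⟩
    · rw [Real.logb_lt_iff_lt_rpow (by norm_num) (by linarith)]
      norm_num
      linarith
    · intro lam u hlam hu
      set β := Real.logb 2 (4 - c) with hβ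
      have h2β : (2 : ℝ) ^ β = 4 - c := two_rpow_logb (by linarith)
      have hβ0 : 0 < β := Real.logb_pos (by norm_num) (by linarith)
      have hu0 : 0 < u := by linarith
      have hlu : 0 < lam * u := by positivity
      obtain ⟨n, hn1, hn2⟩ := exists_nat_pow_near hlam (by norm_num : (1 : ℝ) < 2)
      have h1 : (4 - c) ^ n ≤ lam ^ β := by
        calc (4 - c) ^ n = ((2 : ℝ) ^ n) ^ β := by
              rw [← Real.rpow_pow_comm (by norm_num), h2β]
          _ ≤ lam ^ β := by gcongr
      have h1' : (4 - c) ^ (n + 1) ≤ 4 * lam ^ β := by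
        rw [pow_succ, mul_comm]
        exact mul_le_mul (by linarith) h1 (pow_nonneg (by linarith) _) (by norm_num)
      have h2 : G (lam * u) ≤ (4 - c) ^ (n + 1) * G u :=
        (hmono _ _ (by positivity) (by gcongr)).trans (hU (n + 1) u hu)
      have h3 := hgG _ hlu
      have h4 := hGg u hu0
      have h6 : 0 ≤ lam ^ β := by positivity
      calc g (lam * u) ≤ C * G (lam * u) := h3
        _ ≤ C * (4 * lam ^ β * G u) := by
          gcongr
          exact h2.trans (mul_le_mul_of_nonneg_right h1' (hG0 u))
        _ ≤ C * (4 * lam ^ β * (C * g u)) := by gcongr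
        _ = 4 * C ^ 2 * lam ^ β * g u := by ring

section

variable {g G : ℝ → ℝ} {C : ℝ}

theorem bddAbove_image_Icc_of_le (hC : 0 ≤ C) (hmono : ∀ u v, 0 ≤ u → u ≤ v → G u ≤ G v)
    (hgG : ∀ u, 0 ≤ u → g u ≤ C * G u) (u : ℝ) : BddAbove (g '' Set.Icc 0 u) := by
  refine ⟨C * G u, ?_⟩
  rintro _ ⟨v, hv, rfl⟩
  exact (hgG v hv.1).trans (mul_le_mul_of_nonneg_left (hmono _ _ hv.1 hv.2) hC)

theorem maximalFunction_le (hC : 0 ≤ C) (hmono : ∀ u v, 0 ≤ u → u ≤ v → G u ≤ G v)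
    (hgG : ∀ u, 0 ≤ u → g u ≤ C * G u) {u : ℝ} (hu : 0 ≤ u) :
    maximalFunction g u ≤ C * G u := by
  refine csSup_le ⟨g 0, 0, ⟨le_rfl, hu⟩, rfl⟩ ?_
  rintro _ ⟨v, hv, rfl⟩
  exact (hgG v hv.1).trans (mul_le_mul_of_nonneg_left (hmono _ _ hv.1 hv.2) hC)

theorem le_maximalFunction (hC : 0 ≤ C) (hmono : ∀ u v, 0 ≤ u → u ≤ v → G u ≤ G v)
    (hgG : ∀ u, 0 ≤ u → g u ≤ C * G u) {u v : ℝ} (hu : 0 ≤ u) (huv : u ≤ v) :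
    g u ≤ maximalFunction g v :=
  le_csSup (bddAbove_image_Icc_of_le hC hmono hgG v) ⟨u, ⟨hu, huv⟩, rfl⟩

end

/-! ### From weak scaling to density lower bounds -/

/-- Under both scaling conditions the mass of a unimodal measure whose Gaussian transform is
comparable with `τ G` is not concentrated near the origin or far away, hence its density is
large. -/
theorem exists_density_lower_bound {d : ℕ} [NeZero d] {g G : ℝ → ℝ} {C c₃ α β θ c C' : ℝ}
    (hC : 1 ≤ C) (hc₃ : 0 < c₃) (hα : 0 < α) (hβ : β < 2) (hc : 0 < c) (hC' : 1 ≤ C')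
    (hG0 : ∀ u, 0 ≤ G u) (hmono : ∀ u v, 0 ≤ u → u ≤ v → G u ≤ G v)
    (hGl : ∀ l u, G (l * u) ≤ (1 + l ^ 2) * G u)
    (hgG : ∀ u, 0 ≤ u → g u ≤ C * G u) (hGg : ∀ u, 0 < u → G u ≤ C * g u)
    (hL : WLSC g α θ c) (hU : WUSC g β θ C') :
    ∃ M c₁ : ℝ, 0 < M ∧ 0 < c₁ ∧
      ∀ (m : Measure (EuclideanSpace ℝ (Fin d))) (f : EuclideanSpace ℝ (Fin d) → ℝ) (b τ : ℝ),
        HasUnimodalDensity m f → Integrable (fun x => min (‖x‖ ^ 2) 1) m → 0 ≤ b → 0 ≤ τ →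
        ∀ x : EuclideanSpace ℝ (Fin d), 0 < ‖x‖ → M * θ * ‖x‖ < 1 →
        (∀ u, 0 < u → u ≤ ‖x‖⁻¹ → c₃ * (τ * G u) ≤ gaussTransform m b (u ^ 2)) →
        (∀ u, gaussTransform m b (u ^ 2) ≤ τ * G u) →
        c₁ * (τ * maximalFunction g (‖x‖⁻¹) / ‖x‖ ^ d) ≤ f x := by
  have hC0 : 0 < C := by linarith
  have hC'0 : 0 < C' := by linarith
  -- The choices of `k` and `l` make each of the two error terms at most `c₃/4 · τ G u`, leaving
  -- `c₃/2 · τ G u` for the annulus.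
  obtain ⟨k, hk1, hk⟩ : ∃ k : ℝ, 1 ≤ k ∧ 8 * C ^ 2 * C' / c₃ ≤ k ^ (2 - β) :=
    ((eventually_ge_atTop 1).and ((tendsto_rpow_atTop (by linarith)).eventually_ge_atTop _)).exists
  obtain ⟨l, hl1, hl⟩ : ∃ l : ℝ, 1 ≤ l ∧ 8 * C ^ 2 / (c * c₃) ≤ l ^ α :=
    ((eventually_ge_atTop 1).and ((tendsto_rpow_atTop hα).eventually_ge_atTop _)).exists
  have hk0 : 0 < k := by linarith
  have hl0 : 0 < l := by linarith
  set ω := volume.real (Metric.ball (0 : EuclideanSpace ℝ (Fin d)) 1) with hω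
  have hω0 : 0 < ω := volume_real_ball_pos d
  -- With `u = 1/(k‖x‖)`, the lowest frequency at which scaling is used is `u / l`, so `M = k l` is
  -- what keeps it above `θ`.
  refine ⟨k * l, c₃ / (2 * C * (1 + k ^ 2) * ((l * k) ^ d * ω)), by positivity, by positivity,
    fun m f b τ hf hm hb hτ x hx hxθ hlow hup => ?_⟩
  set u := (k * ‖x‖)⁻¹ with hu
  have hu0 : 0 < u := by positivity
  have hku : k * u = ‖x‖⁻¹ := by rw [hu]; field_simp
  have huθ' : θ < u / l := by
    rw [hu, lt_div_iff₀ hl0, ← one_div, lt_div_iff₀ (by positivity)]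
    linarith
  have huθ : θ < u := huθ'.trans_le (div_le_self hu0.le hl1)
  have key := hf.gaussTransform_le hm hb hu0 hk1 hl1 (x := x) (by rw [hku, inv_inv])
  rw [← hω] at key
  have hGu := hG0 u
  have hgu : g u ≤ C * G u := hgG u hu0.le
  have hz : 0 ≤ τ * G u := mul_nonneg hτ hGu
  have h1 : 2 / k ^ 2 * gaussTransform m b ((k * u) ^ 2) ≤ c₃ / 4 * (τ * G u) := by
    have e1 : G (k * u) ≤ C ^ 2 * C' * k ^ β * G u :=
      calc G (k * u) ≤ C * g (k * u) := hGg _ (by positivity)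
        _ ≤ C * (C' * k ^ β * g u) := by gcongr; exact hU k u hk1 huθ
        _ ≤ C * (C' * k ^ β * (C * G u)) := by gcongr
        _ = _ := by ring
    have e2 : k ^ (2 - β) * k ^ β = k ^ 2 := by
      rw [← Real.rpow_add hk0]; norm_num
    have e3 : 8 * C ^ 2 * C' * k ^ β ≤ c₃ * k ^ 2 := by
      rw [← e2, ← mul_assoc]
      refine mul_le_mul_of_nonneg_right ?_ (by positivity)
      rw [div_le_iff₀ hc₃] at hk
      linarith
    calc 2 / k ^ 2 * gaussTransform m b ((k * u) ^ 2)
        ≤ 2 / k ^ 2 * (τ * (C ^ 2 * C' * k ^ β * G u)) := by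
          gcongr
          exact (hup _).trans (mul_le_mul_of_nonneg_left e1 hτ)
      _ = (8 * C ^ 2 * C' * k ^ β) * (τ * G u) / (4 * k ^ 2) := by field_simp; ring
      _ ≤ (c₃ * k ^ 2) * (τ * G u) / (4 * k ^ 2) := by gcongr
      _ = _ := by field_simp
  have h2 : 2 * gaussTransform m b ((u / l) ^ 2) ≤ c₃ / 4 * (τ * G u) := by
    have e0 : c * l ^ α * g (u / l) ≤ g u := by
      have := hL l (u / l) hl1 huθ'
      rwa [mul_div_cancel₀ _ hl0.ne'] at this
    have e1 : c * l ^ α * G (u / l) ≤ C ^ 2 * G u :=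
      calc c * l ^ α * G (u / l) ≤ c * l ^ α * (C * g (u / l)) := by
            gcongr; exact hGg _ (by positivity)
        _ = C * (c * l ^ α * g (u / l)) := by ring
        _ ≤ C * (C * G u) := mul_le_mul_of_nonneg_left (e0.trans hgu) hC0.le
        _ = _ := by ring
    rw [div_le_iff₀ (by positivity)] at hl
    have e2 : 8 * C ^ 2 * G (u / l) ≤ C ^ 2 * (c₃ * G u) :=
      calc 8 * C ^ 2 * G (u / l) ≤ l ^ α * (c * c₃) * G (u / l) :=
            mul_le_mul_of_nonneg_right hl (hG0 _)
        _ = c₃ * (c * l ^ α * G (u / l)) := by ring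
        _ ≤ c₃ * (C ^ 2 * G u) := by gcongr
        _ = _ := by ring
    have e3 : 8 * G (u / l) ≤ c₃ * G u := by
      refine le_of_mul_le_mul_left ?_ (show 0 < C ^ 2 by positivity)
      linarith
    have e4 := hup (u / l)
    nlinarith
  have h3 := hlow u hu0 (by rw [← hku]; nlinarith)
  have hlu : l / u = l * k * ‖x‖ := by rw [hu]; field_simp
  rw [hlu, mul_pow (l * k)] at key
  have h4 : c₃ / 2 * (τ * G u) ≤ f x * ((l * k) ^ d * ‖x‖ ^ d * ω) := by linarith
  have h5 : maximalFunction g (‖x‖⁻¹) ≤ C * ((1 + k ^ 2) * G u) := by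
    rw [← hku]
    refine (maximalFunction_le hC0.le hmono hgG (by positivity)).trans ?_
    gcongr
    exact hGl k u
  calc c₃ / (2 * C * (1 + k ^ 2) * ((l * k) ^ d * ω)) *
        (τ * maximalFunction g (‖x‖⁻¹) / ‖x‖ ^ d)
      ≤ c₃ / (2 * C * (1 + k ^ 2) * ((l * k) ^ d * ω)) *
        (τ * (C * ((1 + k ^ 2) * G u)) / ‖x‖ ^ d) := by gcongr
    _ = c₃ / 2 * (τ * G u) / ((l * k) ^ d * ‖x‖ ^ d * ω) := by field_simp
    _ ≤ f x := by rw [div_le_iff₀ (by positivity)]; exact h4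

/-- Used to discard the quadratic error `C (t G)²` after division by `t`. -/
theorem le_of_forall_small_le_add_mul {a e D δ : ℝ} (hδ : 0 < δ)
    (h : ∀ t : ℝ, 0 < t → t < δ → a ≤ e + t * D) : a ≤ e := by
  have ht : Tendsto (fun t : ℝ => e + t * D) (𝓝[>] 0) (𝓝 (e + 0 * D)) :=
    (Continuous.tendsto (by fun_prop) 0).mono_left nhdsWithin_le_nhds
  rw [zero_mul, add_zero] at ht
  refine ge_of_tendsto ht ?_
  filter_upwards [Ioo_mem_nhdsGT hδ] with t ht
  exact h t ht.1 ht.2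

/-! ### The implications for the Lévy process -/

section

variable {d : ℕ} [NeZero d] {Ω : Type*} [MeasurableSpace Ω]
  {P : Measure Ω} [IsProbabilityMeasure P] {X : ℝ≥0 → Ω → EuclideanSpace ℝ (Fin d)}
  {p : ℝ≥0 → EuclideanSpace ℝ (Fin d) → ℝ} {ψ : EuclideanSpace ℝ (Fin d) → ℝ}
  {N : Measure (EuclideanSpace ℝ (Fin d))} {ν : EuclideanSpace ℝ (Fin d) → ℝ}

/-- A majorant of the exponent comparable with its radial profile `g`: the function `G` is
the Gaussian transform of the Lévy measure, evaluated at `u ^ 2`. -/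
theorem HasLevyKhintchine.exists_comparison (hX : ∀ t, Measurable (X t))
    (hψ : HasLevyKhintchine P X ψ N) (hν : HasUnimodalDensity N ν) :
    ∃ (b C : ℝ) (G : ℝ → ℝ), 0 ≤ b ∧ 1 ≤ C ∧ (∀ u, G u = gaussTransform N b (u ^ 2)) ∧
      (∀ u, 0 ≤ G u) ∧ (∀ u v, 0 ≤ u → u ≤ v → G u ≤ G v) ∧
      (∀ l u, G (l * u) ≤ (1 + l ^ 2) * G u) ∧
      (∀ u, 0 ≤ u → radialProfile ψ u ≤ C * G u) ∧
      (∀ u, 0 < u → G u ≤ C * radialProfile ψ u) ∧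
      ∀ (t : ℝ≥0) (u : ℝ), gaussTransform (P.map (X t)) 0 (u ^ 2) ≤ t * G u ∧
        ∀ k, 0 ≤ k → k ≤ 1 →
          k * (t * G u) - k ^ 2 * C * (t * G u) ^ 2 ≤ gaussTransform (P.map (X t)) 0 (u ^ 2) := by
  obtain ⟨σ, hσ, hf⟩ := hψ.formula
  have hN := hψ.isLevyMeasure
  obtain ⟨b, C, hb, hC, h1, h2, h3⟩ := exists_gaussTransform_comparison hN hν hσ hf
  have hm := hN.integrable_min
  refine ⟨b, C, fun u => gaussTransform N b (u ^ 2), hb, hC, fun _ => rfl,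
    fun u => gaussTransform_nonneg hb (sq_nonneg u),
    fun u v hu huv => gaussTransform_mono hm hb (sq_nonneg u) (by gcongr),
    fun l u => gaussTransform_sq_mul_le hm hb l u, fun u hu => ?_, h2, fun t u => ?_⟩
  · have := h1 (EuclideanSpace.single 0 u)
    rwa [show ‖(EuclideanSpace.single 0 u : EuclideanSpace ℝ (Fin d))‖ = u by
      simp [abs_of_nonneg hu]] at this
  · exact h3 t _ (Measure.isProbabilityMeasure_map (hX t).aemeasurable) (hψ.charFun_eq t) u

theorem exists_norm_eq_inv {u : ℝ} (hu : 0 < u) :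
    ∃ x : EuclideanSpace ℝ (Fin d), ‖x‖ = u⁻¹ :=
  ⟨EuclideanSpace.single 0 u⁻¹, by simp [abs_of_pos hu]⟩

theorem HasLevyKhintchine.levyDensity_lower_bound (hX : ∀ t, Measurable (X t))
    (hψ : HasLevyKhintchine P X ψ N) (hν : HasUnimodalDensity N ν) {α β θ c C' : ℝ}
    (hα : 0 < α) (hβ : β < 2) (hc : 0 < c) (hC' : 1 ≤ C')
    (hL : WLSC (radialProfile ψ) α θ c) (hU : WUSC (radialProfile ψ) β θ C') :
    ∃ M c₁ : ℝ, 0 < M ∧ 0 < c₁ ∧ ∀ x : EuclideanSpace ℝ (Fin d), 0 < ‖x‖ → M * θ * ‖x‖ < 1 →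
      c₁ * (maximalFunction (radialProfile ψ) (‖x‖⁻¹) / ‖x‖ ^ d) ≤ ν x := by
  obtain ⟨b, C, G, hb, hC, hG, hG0, hmono, hGl, hgG, hGg, -⟩ := hψ.exists_comparison hX hν
  obtain ⟨M, c₁, hM, hc₁, h⟩ := exists_density_lower_bound (d := d) (c₃ := 1) hC one_pos hα hβ
    hc hC' hG0 hmono hGl hgG hGg hL hU
  refine ⟨M, c₁, hM, hc₁, fun x hx hxθ => ?_⟩
  have := h N ν b 1 hν hψ.isLevyMeasure.integrable_min hb zero_le_one x hx hxθ
    (fun u _ _ => by rw [hG]; simp) (fun u => by rw [hG]; simp)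
  rwa [one_mul] at this

theorem HasLevyKhintchine.transitionDensity_lower_bound (hX : ∀ t, Measurable (X t))
    (hp : ∀ t, 0 < t → HasUnimodalDensity (P.map (X t)) (p t))
    (hψ : HasLevyKhintchine P X ψ N) (hν : HasUnimodalDensity N ν) {α β θ c C' : ℝ}
    (hα : 0 < α) (hβ : β < 2) (hc : 0 < c) (hC' : 1 ≤ C')
    (hL : WLSC (radialProfile ψ) α θ c) (hU : WUSC (radialProfile ψ) β θ C') :
    ∃ M c₁ : ℝ, 0 < M ∧ 0 < c₁ ∧ ∀ (t : ℝ≥0) (x : EuclideanSpace ℝ (Fin d)),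
      0 < ‖x‖ → M * θ * ‖x‖ < 1 →
      0 < t * maximalFunction (radialProfile ψ) (‖x‖⁻¹) →
      t * maximalFunction (radialProfile ψ) (‖x‖⁻¹) < 1 →
      c₁ * (t * maximalFunction (radialProfile ψ) (‖x‖⁻¹) / ‖x‖ ^ d) ≤ p t x := by
  obtain ⟨b, C, G, hb, hC, hG, hG0, hmono, hGl, hgG, hGg, hF⟩ := hψ.exists_comparison hX hν
  have hC0 : 0 < C := by linarith
  obtain ⟨M, c₁, hM, hc₁, h⟩ := exists_density_lower_bound (d := d) (c₃ := (4 * C ^ 2)⁻¹) hC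
    (by positivity) hα hβ hc hC' hG0 hmono hGl hgG hGg hL hU
  refine ⟨M, c₁, hM, hc₁, fun t x hx hxθ h0 h1 => ?_⟩
  have ht : 0 < t := by
    rcases eq_or_ne t 0 with rfl | h
    · simp at h0
    · exact pos_iff_ne_zero.2 h
  have : IsProbabilityMeasure (P.map (X t)) :=
    Measure.isProbabilityMeasure_map (hX t).aemeasurable
  refine h (P.map (X t)) (p t) 0 t (hp t ht) (integrable_min_of_isFiniteMeasure _) le_rfl t.2 x
    hx hxθ (fun u hu hux => ?_) (fun u => (hF t u).1)
  -- The restriction `t ψ^*(1/|x|) < 1` keeps `t G u` bounded for `u ≤ 1/|x|`.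
  have hz : t * G u ≤ C :=
    calc t * G u ≤ t * (C * radialProfile ψ u) :=
          mul_le_mul_of_nonneg_left (hGg u hu) t.2
      _ ≤ t * (C * maximalFunction (radialProfile ψ) ‖x‖⁻¹) := by
          gcongr
          exact le_maximalFunction hC0.le hmono hgG hu.le hux
      _ = C * (t * maximalFunction (radialProfile ψ) ‖x‖⁻¹) := by ring
      _ ≤ C * 1 := by gcongr
      _ = C := mul_one C
  have hz0 : 0 ≤ t * G u := mul_nonneg t.2 (hG0 u)
  -- For `z = t G u ≤ C` and `k = 1/(2C²)`, the quadratic term `k² C z²` is at most half of `k z`,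
  -- which leaves the slope `1/(4C²)`.
  refine le_trans ?_ ((hF t u).2 (2 * C ^ 2)⁻¹ (by positivity)
    (inv_le_one_of_one_le₀ (by nlinarith)))
  set z := t * G u with hzdef
  have e : (2 * C ^ 2)⁻¹ * z - (2 * C ^ 2)⁻¹ ^ 2 * C * z ^ 2 - (4 * C ^ 2)⁻¹ * z =
      (4 * C ^ 3)⁻¹ * (z * (C - z)) := by
    field_simp; ring
  have : 0 ≤ (4 * C ^ 3)⁻¹ * (z * (C - z)) :=
    mul_nonneg (by positivity) (mul_nonneg hz0 (by linarith))
  linarith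

/-- The hypothesis at `|x| = 1/u`, inserted in `HasUnimodalDensity.gaussTransform_doubling`, bounds
both doubling differences of `G` below by a multiple of `ψ^*(u)`, hence of `G u`. -/
theorem HasLevyKhintchine.scaling_of_levyDensity (hX : ∀ t, Measurable (X t))
    (hψ : HasLevyKhintchine P X ψ N) (hν : HasUnimodalDensity N ν) {θ c : ℝ} (hθ : 0 ≤ θ)
    (hc : 0 < c)
    (h : ∀ x : EuclideanSpace ℝ (Fin d), 0 < ‖x‖ → θ * ‖x‖ < 1 →
      c * (maximalFunction (radialProfile ψ) (‖x‖⁻¹) / ‖x‖ ^ d) ≤ ν x) :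
    (∃ α c', 0 < α ∧ α < 2 ∧ 0 < c' ∧ c' ≤ 1 ∧ WLSC (radialProfile ψ) α θ c') ∧
      ∃ β C', 0 < β ∧ β < 2 ∧ 1 ≤ C' ∧ WUSC (radialProfile ψ) β θ C' := by
  obtain ⟨b, C, G, hb, hC, hG, hG0, hmono, hGl, hgG, hGg, -⟩ := hψ.exists_comparison hX hν
  have hC0 : 0 < C := by linarith
  set ω := volume.real (Metric.ball (0 : EuclideanSpace ℝ (Fin d)) 1) with hω
  have hω0 : 0 < ω := volume_real_ball_pos d
  have key : ∀ u, θ < u → min 1 (c * ω / (20 * C)) * G u ≤ G (2 * u) - G u ∧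
      min 1 (c * ω / (20 * C)) * G u ≤ 4 * G u - G (2 * u) := by
    intro u hu
    have hu0 : 0 < u := by linarith
    obtain ⟨x, hx⟩ := exists_norm_eq_inv (d := d) hu0
    have hx0 : 0 < ‖x‖ := by rw [hx]; positivity
    have h1 := h x hx0 (by rw [hx, ← div_eq_mul_inv, div_lt_one hu0]; exact hu)
    have h2 := hν.gaussTransform_doubling hψ.isLevyMeasure.integrable_min hb hu0 hx
    rw [← hω, ← hG, ← hG] at h2
    have h3 : min 1 (c * ω / (20 * C)) * G u ≤ ν x * (‖x‖ ^ d * ω) / 20 :=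
      calc min 1 (c * ω / (20 * C)) * G u
          ≤ c * ω / (20 * C) * (C * maximalFunction (radialProfile ψ) (‖x‖⁻¹)) := by
            refine mul_le_mul (min_le_right _ _) ((hGg u hu0).trans ?_) (hG0 u) (by positivity)
            gcongr
            exact le_maximalFunction hC0.le hmono hgG hu0.le (by rw [hx, inv_inv])
        _ = c * (maximalFunction (radialProfile ψ) (‖x‖⁻¹) / ‖x‖ ^ d) * (‖x‖ ^ d * ω) / 20 := by
            field_simp
        _ ≤ _ := by gcongr
    exact ⟨h3.trans h2.1, h3.trans h2.2⟩
  exact scaling_of_doubling hC (lt_min one_pos (by positivity)) (min_le_left _ _) hθ hG0 hmono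
    (fun u hu => hgG u hu.le) hGg (fun u hu => (key u hu).1) (fun u hu => (key u hu).2)

theorem HasLevyKhintchine.scaling_of_transitionDensity (hX : ∀ t, Measurable (X t))
    (hp : ∀ t, 0 < t → HasUnimodalDensity (P.map (X t)) (p t))
    (hψ : HasLevyKhintchine P X ψ N) (hν : HasUnimodalDensity N ν) {θ c : ℝ} (hθ : 0 ≤ θ)
    (hc : 0 < c)
    (h : ∀ (t : ℝ≥0) (x : EuclideanSpace ℝ (Fin d)), 0 < ‖x‖ → θ * ‖x‖ < 1 →
      0 < t * maximalFunction (radialProfile ψ) (‖x‖⁻¹) →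
      t * maximalFunction (radialProfile ψ) (‖x‖⁻¹) < 1 →
      c * (t * maximalFunction (radialProfile ψ) (‖x‖⁻¹) / ‖x‖ ^ d) ≤ p t x) :
    (∃ α c', 0 < α ∧ α < 2 ∧ 0 < c' ∧ c' ≤ 1 ∧ WLSC (radialProfile ψ) α θ c') ∧
      ∃ β C', 0 < β ∧ β < 2 ∧ 1 ≤ C' ∧ WUSC (radialProfile ψ) β θ C' := by
  obtain ⟨b, C, G, hb, hC, hG, hG0, hmono, hGl, hgG, hGg, hF⟩ := hψ.exists_comparison hX hν
  have hC0 : 0 < C := by linarith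
  set ω := volume.real (Metric.ball (0 : EuclideanSpace ℝ (Fin d)) 1) with hω
  have hω0 : 0 < ω := volume_real_ball_pos d
  set c₀ := min 1 (c * ω / (20 * C)) with hc₀
  have hc₀0 : 0 < c₀ := lt_min one_pos (by positivity)
  have key : ∀ u, θ < u → c₀ * G u ≤ G (2 * u) - G u ∧ c₀ * G u ≤ 4 * G u - G (2 * u) := by
    intro u hu
    have hu0 : 0 < u := by linarith
    obtain ⟨x, hx⟩ := exists_norm_eq_inv (d := d) hu0
    have hx0 : 0 < ‖x‖ := by rw [hx]; positivity
    have hxθ : θ * ‖x‖ < 1 := by rw [hx, ← div_eq_mul_inv, div_lt_one hu0]; exact hu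
    set S := maximalFunction (radialProfile ψ) (‖x‖⁻¹) with hS
    have hGS : G u ≤ C * S := by
      refine (hGg u hu0).trans ?_
      gcongr
      exact le_maximalFunction hC0.le hmono hgG hu0.le (by rw [hx, inv_inv])
    -- If `G u = 0`, then `G (2u) = 0` as well and both inequalities are trivial; otherwise `S > 0`
    -- and small times are admissible.
    rcases (hG0 u).eq_or_lt with hGu | hGu
    · have h1 := hGl 2 u
      have h2 := hG0 (2 * u)
      rw [← hGu] at h1 ⊢
      constructor <;> linarith
    have hS0 : 0 < S := pos_of_mul_pos_right (hGu.trans_le hGS) hC0.le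
    have main : ∀ t : ℝ, 0 < t → t < S⁻¹ →
        c₀ * (t * G u) ≤ t * G (2 * u) - (t * G u - C * (t * G u) ^ 2) ∧
        c₀ * (t * G u) ≤ 4 * (t * G u) - (t * G (2 * u) - C * (t * G (2 * u)) ^ 2) := by
      intro t ht htS
      lift t to ℝ≥0 using ht.le
      have htS' : (t : ℝ) * S < 1 := by
        rwa [← one_div, lt_div_iff₀ hS0] at htS
      have h1 := h t x hx0 hxθ (mul_pos ht hS0) htS'
      have : IsProbabilityMeasure (P.map (X t)) :=
        Measure.isProbabilityMeasure_map (hX t).aemeasurable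
      have h2 := (hp t (by exact_mod_cast ht)).gaussTransform_doubling
        (integrable_min_of_isFiniteMeasure _) le_rfl hu0 hx
      rw [← hω] at h2
      have h3 : c₀ * (t * G u) ≤ p t x * (‖x‖ ^ d * ω) / 20 :=
        calc c₀ * (t * G u) ≤ c * ω / (20 * C) * (t * (C * S)) :=
              mul_le_mul (min_le_right _ _) (by gcongr) (by positivity) (by positivity)
          _ = c * (t * S / ‖x‖ ^ d) * (‖x‖ ^ d * ω) / 20 := by field_simp
          _ ≤ _ := by gcongr
      obtain ⟨h4, h5⟩ := hF t u
      obtain ⟨h6, h7⟩ := hF t (2 * u)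
      -- Here `k = 1` is essential: the linear terms of the upper and lower bounds must agree in the
      -- limit `t → 0`.
      have h5 := h5 1 zero_le_one le_rfl
      have h7 := h7 1 zero_le_one le_rfl
      constructor <;> linarith [h2.1, h2.2]
    constructor
    · refine le_of_forall_small_le_add_mul (D := C * G u ^ 2) (inv_pos.2 hS0) fun t ht htS => ?_
      refine le_of_mul_le_mul_left ?_ ht
      linarith [(main t ht htS).1]
    · refine le_of_forall_small_le_add_mul (D := C * G (2 * u) ^ 2) (inv_pos.2 hS0)
        fun t ht htS => ?_
      refine le_of_mul_le_mul_left ?_ ht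
      linarith [(main t ht htS).2]
  exact scaling_of_doubling hC hc₀0 (min_le_left _ _) hθ hG0 hmono
    (fun u hu => hgG u hu.le) hGg (fun u hu => (key u hu).1) (fun u hu => (key u hu).2)

end

/-! ### Thresholds and the equivalences -/

theorem WLSC.mono_threshold {φ : ℝ → ℝ} {α θ θ' c : ℝ} (h : WLSC φ α θ c) (hθ : θ ≤ θ') :
    WLSC φ α θ' c := fun lam u hlam hu => h lam u hlam (hθ.trans_lt hu)

theorem WUSC.mono_threshold {φ : ℝ → ℝ} {α θ θ' C : ℝ} (h : WUSC φ α θ C) (hθ : θ ≤ θ') :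
    WUSC φ α θ' C := fun lam u hlam hu => h lam u hlam (hθ.trans_lt hu)

theorem mul_lt_one_of_lt_inv_add_one {a s : ℝ} (ha : 0 ≤ a) (hs : 0 < s) (h : s < (a + 1)⁻¹) :
    a * s < 1 := by
  rw [← one_div, lt_div_iff₀ (by linarith)] at h
  linarith

theorem theorem5 {d : ℕ} [NeZero d] {Ω : Type*} [MeasurableSpace Ω]
    (P : Measure Ω) [IsProbabilityMeasure P]
    (X : ℝ≥0 → Ω → EuclideanSpace ℝ (Fin d)) (hX : IsLevyProcess P X)
    -- every one-dimensional distribution is isotropic unimodal, with density `p t`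
    (p : ℝ≥0 → EuclideanSpace ℝ (Fin d) → ℝ)
    (hp : ∀ t, 0 < t → HasUnimodalDensity (P.map (X t)) (p t))
    -- the exponent `ψ` and the Lévy measure `N`, with isotropic unimodal density `ν`
    (ψ : EuclideanSpace ℝ (Fin d) → ℝ) (N : Measure (EuclideanSpace ℝ (Fin d)))
    (hψ : HasLevyKhintchine P X ψ N)
    (ν : EuclideanSpace ℝ (Fin d) → ℝ) (hν : HasUnimodalDensity N ν) :
    -- local version
    List.TFAE [
      HasWLSC (radialProfile ψ) ∧ HasWUSC (radialProfile ψ),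
      ∃ r c : ℝ, 0 < r ∧ 0 < c ∧ ∀ (t : ℝ≥0) (x : EuclideanSpace ℝ (Fin d)),
        0 < ‖x‖ → ‖x‖ < r →
        0 < t * maximalFunction (radialProfile ψ) (‖x‖⁻¹) →
        t * maximalFunction (radialProfile ψ) (‖x‖⁻¹) < 1 →
        c * (t * maximalFunction (radialProfile ψ) (‖x‖⁻¹) / ‖x‖ ^ d) ≤ p t x,
      ∃ r c : ℝ, 0 < r ∧ 0 < c ∧ ∀ x : EuclideanSpace ℝ (Fin d),
        0 < ‖x‖ → ‖x‖ < r →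
        c * (maximalFunction (radialProfile ψ) (‖x‖⁻¹) / ‖x‖ ^ d) ≤ ν x] ∧
    -- global version
    List.TFAE [
      HasGlobalWLSC (radialProfile ψ) ∧ HasGlobalWUSC (radialProfile ψ),
      ∃ c : ℝ, 0 < c ∧ ∀ (t : ℝ≥0) (x : EuclideanSpace ℝ (Fin d)),
        0 < ‖x‖ →
        0 < t * maximalFunction (radialProfile ψ) (‖x‖⁻¹) →
        t * maximalFunction (radialProfile ψ) (‖x‖⁻¹) < 1 →
        c * (t * maximalFunction (radialProfile ψ) (‖x‖⁻¹) / ‖x‖ ^ d) ≤ p t x,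
      ∃ c : ℝ, 0 < c ∧ ∀ x : EuclideanSpace ℝ (Fin d),
        0 < ‖x‖ →
        c * (maximalFunction (radialProfile ψ) (‖x‖⁻¹) / ‖x‖ ^ d) ≤ ν x] := by
  have hm := hX.measurable
  constructor
  · tfae_have 1 → 2 := by
      rintro ⟨⟨α, θ₁, c, hα, -, hθ₁, hc, -, hL⟩, β, θ₂, C', -, hβ, hθ₂, hC', hU⟩
      have hθ : 0 ≤ max θ₁ θ₂ := hθ₁.trans (le_max_left _ _)
      obtain ⟨M, c₁, hM, hc₁, h⟩ := hψ.transitionDensity_lower_bound hm hp hν hα hβ hc hC'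
        (hL.mono_threshold (le_max_left _ _)) (hU.mono_threshold (le_max_right _ _))
      have hMθ := mul_nonneg hM.le hθ
      -- The added 1 keeps the radius finite and positive when both thresholds vanish.
      exact ⟨(M * max θ₁ θ₂ + 1)⁻¹, c₁, by positivity, hc₁, fun t x hx hxr =>
        h t x hx (mul_lt_one_of_lt_inv_add_one hMθ hx hxr)⟩
    tfae_have 2 → 1 := by
      rintro ⟨r, c, hr, hc, h⟩
      obtain ⟨⟨α, c', h1, h2, h3, h4, h5⟩, β, C', h6, h7, h8, h9⟩ :=
        hψ.scaling_of_transitionDensity hm hp hν (inv_nonneg.2 hr.le) hc fun t x hx hxr =>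
          h t x hx (by rwa [inv_mul_lt_one₀ hr] at hxr)
      exact ⟨⟨α, r⁻¹, c', h1, h2, inv_nonneg.2 hr.le, h3, h4, h5⟩,
        β, r⁻¹, C', h6, h7, inv_nonneg.2 hr.le, h8, h9⟩
    tfae_have 1 → 3 := by
      rintro ⟨⟨α, θ₁, c, hα, -, hθ₁, hc, -, hL⟩, β, θ₂, C', -, hβ, hθ₂, hC', hU⟩
      have hθ : 0 ≤ max θ₁ θ₂ := hθ₁.trans (le_max_left _ _)
      obtain ⟨M, c₁, hM, hc₁, h⟩ := hψ.levyDensity_lower_bound hm hν hα hβ hc hC'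
        (hL.mono_threshold (le_max_left _ _)) (hU.mono_threshold (le_max_right _ _))
      have hMθ := mul_nonneg hM.le hθ
      exact ⟨(M * max θ₁ θ₂ + 1)⁻¹, c₁, by positivity, hc₁, fun x hx hxr =>
        h x hx (mul_lt_one_of_lt_inv_add_one hMθ hx hxr)⟩
    tfae_have 3 → 1 := by
      rintro ⟨r, c, hr, hc, h⟩
      obtain ⟨⟨α, c', h1, h2, h3, h4, h5⟩, β, C', h6, h7, h8, h9⟩ :=
        hψ.scaling_of_levyDensity hm hν (inv_nonneg.2 hr.le) hc fun x hx hxr =>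
          h x hx (by rwa [inv_mul_lt_one₀ hr] at hxr)
      exact ⟨⟨α, r⁻¹, c', h1, h2, inv_nonneg.2 hr.le, h3, h4, h5⟩,
        β, r⁻¹, C', h6, h7, inv_nonneg.2 hr.le, h8, h9⟩
    tfae_finish
  · tfae_have 1 → 2 := by
      rintro ⟨⟨α, c, hα, -, hc, -, hL⟩, β, C', -, hβ, hC', hU⟩
      obtain ⟨M, c₁, -, hc₁, h⟩ :=
        hψ.transitionDensity_lower_bound hm hp hν hα hβ hc hC' hL hU
      exact ⟨c₁, hc₁, fun t x hx => h t x hx (by simp)⟩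
    tfae_have 2 → 1 := by
      rintro ⟨c, hc, h⟩
      exact hψ.scaling_of_transitionDensity hm hp hν le_rfl hc fun t x hx _ => h t x hx
    tfae_have 1 → 3 := by
      rintro ⟨⟨α, c, hα, -, hc, -, hL⟩, β, C', -, hβ, hC', hU⟩
      obtain ⟨M, c₁, -, hc₁, h⟩ := hψ.levyDensity_lower_bound hm hν hα hβ hc hC' hL hU
      exact ⟨c₁, hc₁, fun x hx => h x hx (by simp)⟩
    tfae_have 3 → 1 := by
      rintro ⟨c, hc, h⟩
      exact hψ.scaling_of_levyDensity hm hν le_rfl hc fun x hx _ => h x hx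
    tfae_finish
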